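/- Let $d\in\{1,2\}$, and let $(p(i,j))_{i,j\in\mathbb Z^d}$ be a stochastic matrix that is homogeneous ($p(i,j)=p(0,j-i)=:p(j-i)$), centered ($\sum_j j\,p(j)=0$), of finite range ($p(j)=0$ for all $|j|>v$, for some $v$) and truly $d$-dimensional ($\{j: p(j)\ne0\}$ generates the group $\mathbb Z^d$). Let $p_r(i,j)$ be the $r$-step transition probabilities of the random walk with transition probabilities $p(i,j)$, write $p_r(j)=p_r(0,j)$, and put $s(n)=\sum_{r=0}^{n-1}\sum_{j\in\mathbb Z^d}p_r(j)^2$. Let $\varepsilon$ and $\varepsilon_n(i)$, $n\ge1$, $i\in\mathbb Z^d$, be i.i.d. integrable symmetric real random variables, not almost surely equal to $0$, whose law is in $\mathcal L_1^-$, that is, there are $b,b'>0$ with $\mathbb P(\varepsilon>x)\le b\,e^{-b'x}$ for all $x>0$. Let $(W_n)_{n\ge0}$ be the wall process: $W_0(i)=0$ and $W_n(i)=\max\bigl(0,\sum_{j}p(i,j)W_{n-1}(j)+\varepsilon_n(i)\bigr)$ for $n\ge1$, $i\in\mathbb Z^d$. Then $W_n(0)$ is integrable for every $n$, and, with $\mu_n=\mathbb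 E\,W_n(0)$, there exist constants $c,C>0$, depending only on $d$, $p$ and the law of $\varepsilon$, such that $$c\sqrt{s(n)}\le\mu_n\ \ (n\ge1),\qquad \mu_n\le C\sqrt{s(n)\log n}\ \ (n\ge2).$$ In particular, with $c,C>0$ suitably chosen, (i) for $d=1$, $c\,n^{1/4}\le\mu_n$ for $n\ge1$ and $\mu_n\le C\,n^{1/4}\sqrt{\log n}$ for $n\ge2$; (ii) for $d=2$, $c\sqrt{\log n}\le\mu_n$ for $n\ge1$ and $\mu_n\le C\log n$ for $n\ge2$. -/

import Mathlib

open MeasureTheory ProbabilityTheory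

namespace SerialHarness

/-- The site lattice `ℤ^d`. -/
abbrev Site (d : ℕ) : Type := Fin d → ℤ

/-- The averaging matrix `𝒫 = (p(i,j))`: a stochastic matrix on `ℤ^d` that is homogeneous, centered,
of finite range and truly `d`-dimensional. (`‖j‖` is the sup norm on `ℤ^d`.) -/
structure IsHarnessKernel {d : ℕ} (p : Site d → Site d → ℝ) : Prop where
  nonneg : ∀ i j, 0 ≤ p i j
  sum_one : ∀ i, HasSum (fun j => p i j) 1
  homogeneous : ∀ i j, p i j = p 0 (j - i)
  centered : ∀ k : Fin d, HasSum (fun j : Site d => (j k : ℝ) * p 0 j) 0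
  finite_range : ∃ v : ℝ, ∀ j : Site d, v < ‖j‖ → p 0 j = 0
  generates : AddSubgroup.closure {j : Site d | p 0 j ≠ 0} = ⊤

/-- The `m`-step transition probabilities `p_m(i,j)` of the random walk with one-step transition
probabilities `p(i,j)`. -/
noncomputable def stepProb {d : ℕ} (p : Site d → Site d → ℝ) : ℕ → Site d → Site d → ℝ
  | 0 => fun i j => if i = j then 1 else 0
  | m + 1 => fun i j => ∑' k : Site d, p i k * stepProb p m k j

/-- `s(n) = ∑_{r=0}^{n-1} ∑_j p_r(j)²`, the expected number of encounters before time `n` of two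
independent walks started at the origin. -/
noncomputable def encounters {d : ℕ} (p : Site d → Site d → ℝ) (n : ℕ) : ℝ :=
  ∑ r ∈ Finset.range n, ∑' j : Site d, stepProb p r 0 j ^ 2

/-- The wall process: `W_0 = 0` and `W_n(i) = (∑_j p(i,j) W_{n-1}(j) + ε_n(i))⁺` for `n ≥ 1`. -/
noncomputable def wall {d : ℕ} {Ω : Type*} (p : Site d → Site d → ℝ)
    (ε : ℕ → Site d → Ω → ℝ) : ℕ → Site d → Ω → ℝ
  | 0 => fun _ _ => 0
  | n + 1 => fun i ω => max (∑' j : Site d, p i j * wall p ε n j ω + ε (n + 1) i ω) 0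

/-- The class `ℒ_α⁻` of laws `F` on `ℝ` whose upper tail `F̄(x) = F((x,∞))` satisfies
`F̄(x) ≤ c exp(-c' x^α)` for all `x > 0`, for some positive `c`, `c'`. -/
def LMinus (α : ℝ) : Set (Measure ℝ) :=
  {F | ∃ c : ℝ, 0 < c ∧ ∃ c' : ℝ, 0 < c' ∧
    ∀ x : ℝ, 0 < x → F.real (Set.Ioi x) ≤ c * Real.exp (-c' * x ^ α)}

/-- Noise laws: integrable, symmetric probability measures on `ℝ` that are not concentrated
at `0`. -/
structure IsNoiseLaw (F : Measure ℝ) : Prop where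
  isProbability : IsProbabilityMeasure F
  integrable : Integrable (fun x : ℝ => x) F
  symmetric : F.map (fun x : ℝ => -x) = F
  nondegenerate : F ≠ Measure.dirac 0

/-- The noise `(ε_n(i))` is an i.i.d. family with common law `F`. -/
structure IsIIDNoise {d : ℕ} {Ω : Type*} [MeasurableSpace Ω] (P : Measure Ω) (F : Measure ℝ)
    (ε : ℕ → Site d → Ω → ℝ) : Prop where
  measurable : ∀ n i, Measurable (ε n i)
  law : ∀ n i, P.map (ε n i) = F
  indep : iIndepFun (fun q : ℕ × Site d => ε q.1 q.2) P

/-- `μ_n = 𝔼 W_n(0)`. -/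
noncomputable def meanHeight {d : ℕ} {Ω : Type*} [MeasurableSpace Ω] (P : Measure Ω)
    (p : Site d → Site d → ℝ) (ε : ℕ → Site d → Ω → ℝ) (n : ℕ) : ℝ :=
  ∫ ω, wall p ε n 0 ω ∂P

end SerialHarness

/-! Remove the wall: the resulting linear process `freeHarness` is a sum of independent terms
`p_r(z) ε_{n-r}(i+z)`, so it is centered with variance `σ² s(n)`, where `σ²` is the variance of the
noise. Since the noise has exponential moments on both sides, its moment generating function is at
most `exp (K t² s(n))` for small `|t|` (`IsIIDNoise.mgf_freeHarness_le`).

Lower bound: the wall process dominates both `0` and the free harness `Y`, hence `Y⁺`, whose mean is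
half of `𝔼|Y|`. The exponential moments bound `𝔼 Y⁴` by a multiple of `s(n)²`, so `Y` cannot carry
its variance on rare large values, and `𝔼|Y|` has order `√s(n)` (`exists_le_meanHeight`).

Upper bound: raise the free harness by `h`. The positive excess of the wall process over it is
averaged by the kernel at each step, and gains at most `(-h - Y)⁺`
(`IsHarnessKernel.wall_excess_succ_le`). With `h` of order `√(s(N) log N)`, an exponential Chebyshev
bound makes the mean of each gain so small that `N` of them together stay below order `h`. The
optimal exponent is of order `√(log N / s(N))`, and it must stay in the range of the moment
generating function bound; this is where `log N = O(s(N))`, hence `d ≤ 2`, enters.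

The growth of `s(n)` requires collision probabilities of order `m^(-d/2)`. The lower estimate is
Chebyshev with Cauchy–Schwarz. The upper one is a Nash argument: the decrease of the collision
probability in one step controls how much `p_m` changes under translations, and a nearly translation
invariant density has small `ℓ²` norm. No local limit theorem or aperiodicity is needed. -/

namespace SerialHarness

/-! ### Finite-range random walk: finite sums and the first two moments. -/

section Kernel

variable {d : ℕ} {p : Site d → Site d → ℝ}

lemma IsHarnessKernel.finite_support (hp : IsHarnessKernel p) :
    (Function.support (p 0)).Finite := by
  obtain ⟨v, hv⟩ := hp.finite_range
  refine ((isCompact_closedBall (0 : Site d) v).finite_of_discrete).subset ?_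
  intro j hj
  by_contra h
  exact hj (hv j (by simpa using h))

/-- The finite set of possible steps of the walk. -/
noncomputable def IsHarnessKernel.steps (hp : IsHarnessKernel p) : Finset (Site d) :=
  hp.finite_support.toFinset

lemma IsHarnessKernel.mem_steps (hp : IsHarnessKernel p) {x : Site d} :
    x ∈ hp.steps ↔ p 0 x ≠ 0 := by
  simp [IsHarnessKernel.steps]

/-- Finite range makes this hold for arbitrary `g`, so the recursions defined through `∑'` are
genuine finite averages, with no summability to check. -/
lemma IsHarnessKernel.tsum_kernel_mul (hp : IsHarnessKernel p) (g : Site d → ℝ) (i : Site d) :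
    ∑' j, p i j * g j = ∑ x ∈ hp.steps, p 0 x * g (i + x) := by
  rw [← (Equiv.addLeft i).tsum_eq (fun j => p i j * g j)]
  have h : ∀ x, p i (i + x) = p 0 x := fun x => by rw [hp.homogeneous]; simp
  simp only [Equiv.coe_addLeft, h]
  refine tsum_eq_sum fun x hx => ?_
  rw [hp.mem_steps, not_not] at hx
  simp [hx]

lemma IsHarnessKernel.sum_steps (hp : IsHarnessKernel p) : ∑ x ∈ hp.steps, p 0 x = 1 := by
  have := hp.tsum_kernel_mul (fun _ => 1) 0
  simp only [mul_one] at this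
  rw [← this, (hp.sum_one 0).tsum_eq]

lemma IsHarnessKernel.sum_steps_mul (hp : IsHarnessKernel p) (k : Fin d) :
    ∑ x ∈ hp.steps, p 0 x * (x k : ℝ) = 0 := by
  have := hp.tsum_kernel_mul (fun j => (j k : ℝ)) 0
  simp only [zero_add] at this
  rw [← this, ← (hp.centered k).tsum_eq]
  simp only [mul_comm]

lemma IsHarnessKernel.stepProb_homogeneous (hp : IsHarnessKernel p) (m : ℕ) :
    ∀ i j, stepProb p m i j = stepProb p m 0 (j - i) := by
  induction m with
  | zero => intro i j; simp [stepProb, eq_comm, sub_eq_zero]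
  | succ m ih =>
    intro i j
    simp only [stepProb]
    rw [hp.tsum_kernel_mul (fun k => stepProb p m k j),
      hp.tsum_kernel_mul (fun k => stepProb p m k (j - i))]
    refine Finset.sum_congr rfl fun x _ => ?_
    rw [ih, ih (0 + x), zero_add, sub_sub]

lemma IsHarnessKernel.stepProb_succ (hp : IsHarnessKernel p) (m : ℕ) (y : Site d) :
    stepProb p (m + 1) 0 y = ∑ x ∈ hp.steps, p 0 x * stepProb p m 0 (y - x) := by
  simp only [stepProb]
  rw [hp.tsum_kernel_mul (fun k => stepProb p m k y)]
  refine Finset.sum_congr rfl fun x _ => ?_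
  rw [hp.stepProb_homogeneous, zero_add]

lemma IsHarnessKernel.stepProb_nonneg (hp : IsHarnessKernel p) (m : ℕ) (y : Site d) :
    0 ≤ stepProb p m 0 y := by
  induction m generalizing y with
  | zero => simp only [stepProb]; split_ifs <;> norm_num
  | succ m ih =>
    rw [hp.stepProb_succ]
    exact Finset.sum_nonneg fun x _ => mul_nonneg (hp.nonneg _ _) (ih _)

lemma IsHarnessKernel.finite_support_stepProb (hp : IsHarnessKernel p) (m : ℕ) :
    (Function.support (stepProb p m 0)).Finite := by
  induction m with
  | zero =>
    refine (Set.finite_singleton (0 : Site d)).subset fun y hy => ?_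
    by_contra h
    exact hy (by simpa [stepProb, eq_comm] using h)
  | succ m ih =>
    refine ((hp.steps.finite_toSet.add ih)).subset fun y hy => ?_
    rw [Function.mem_support, hp.stepProb_succ] at hy
    obtain ⟨x, hx, hne⟩ := Finset.exists_ne_zero_of_sum_ne_zero hy
    exact ⟨x, hx, y - x, right_ne_zero_of_mul hne, by simp⟩

lemma IsHarnessKernel.summable_stepProb_mul (hp : IsHarnessKernel p) (m : ℕ) (g : Site d → ℝ) :
    Summable fun y => stepProb p m 0 y * g y :=
  summable_of_hasFiniteSupport ((hp.finite_support_stepProb m).subset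
    fun _ hy => left_ne_zero_of_mul hy)

lemma tsum_stepProb_zero_mul (g : Site d → ℝ) :
    ∑' y, stepProb p 0 0 y * g y = g 0 := by
  rw [tsum_eq_single 0]
  · simp [stepProb]
  · intro y hy
    simp [stepProb, hy.symm]

/-- Conditioning on the first step; mass, moments and the free harness expansion all follow from it
by induction. -/
lemma IsHarnessKernel.tsum_stepProb_succ_mul (hp : IsHarnessKernel p) (m : ℕ)
    (g : Site d → ℝ) :
    ∑' y, stepProb p (m + 1) 0 y * g y =
      ∑ x ∈ hp.steps, p 0 x * ∑' y, stepProb p m 0 y * g (x + y) := by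
  have h1 : ∀ x : Site d, HasSum (fun y => p 0 x * stepProb p m 0 (y - x) * g y)
      (p 0 x * ∑' y, stepProb p m 0 y * g (x + y)) := fun x => by
    rw [← (Equiv.addLeft x).hasSum_iff]
    have := ((hp.summable_stepProb_mul m (fun y => g (x + y))).hasSum).mul_left (p 0 x)
    simpa [Function.comp_def, mul_assoc] using this
  rw [← (hasSum_sum fun x (_ : x ∈ hp.steps) => h1 x).tsum_eq]
  refine tsum_congr fun y => ?_
  rw [hp.stepProb_succ, Finset.sum_mul]

lemma IsHarnessKernel.tsum_stepProb (hp : IsHarnessKernel p) (m : ℕ) :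
    ∑' y, stepProb p m 0 y = 1 := by
  suffices ∑' y, stepProb p m 0 y * (1 : ℝ) = 1 by simpa using this
  induction m with
  | zero => exact tsum_stepProb_zero_mul fun _ => 1
  | succ m ih =>
    rw [hp.tsum_stepProb_succ_mul m fun _ => 1, ih]
    simpa using hp.sum_steps

lemma IsHarnessKernel.tsum_stepProb_coord (hp : IsHarnessKernel p) (m : ℕ) (k : Fin d) :
    ∑' y, stepProb p m 0 y * (y k : ℝ) = 0 := by
  induction m with
  | zero => simpa using tsum_stepProb_zero_mul (p := p) fun y : Site d => (y k : ℝ)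
  | succ m ih =>
    rw [hp.tsum_stepProb_succ_mul m fun y => (y k : ℝ), ← hp.sum_steps_mul k]
    refine Finset.sum_congr rfl fun x _ => ?_
    have h1 := hp.summable_stepProb_mul m fun _ => (x k : ℝ)
    have h2 := hp.summable_stepProb_mul m fun y => (y k : ℝ)
    simp only [Pi.add_apply, Int.cast_add, mul_add]
    rw [h1.tsum_add h2, ih, tsum_mul_right, hp.tsum_stepProb]
    ring

/-- Variances of independent steps add: the cross term vanishes because the walk is centered. -/
lemma IsHarnessKernel.tsum_stepProb_coord_sq (hp : IsHarnessKernel p) (m : ℕ) (k : Fin d) :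
    ∑' y, stepProb p m 0 y * (y k : ℝ) ^ 2 =
      m * ∑ x ∈ hp.steps, p 0 x * (x k : ℝ) ^ 2 := by
  induction m with
  | zero => simp [tsum_stepProb_zero_mul (p := p) fun y : Site d => (y k : ℝ) ^ 2]
  | succ m ih =>
    rw [hp.tsum_stepProb_succ_mul m fun y => (y k : ℝ) ^ 2]
    have key : ∀ x : Site d, ∑' y, stepProb p m 0 y * ((x + y) k : ℝ) ^ 2 =
        (x k : ℝ) ^ 2 + ∑' y, stepProb p m 0 y * (y k : ℝ) ^ 2 := fun x => by
      have h1 := hp.summable_stepProb_mul m fun _ => (x k : ℝ) ^ 2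
      have h2 := hp.summable_stepProb_mul m fun y => (y k : ℝ)
      have h3 := hp.summable_stepProb_mul m fun y => (y k : ℝ) ^ 2
      have e : ∀ y : Site d, stepProb p m 0 y * ((x + y) k : ℝ) ^ 2 =
          stepProb p m 0 y * (x k : ℝ) ^ 2 +
            (2 * x k) * (stepProb p m 0 y * (y k : ℝ)) +
            stepProb p m 0 y * (y k : ℝ) ^ 2 := fun y => by
        simp only [Pi.add_apply, Int.cast_add]; ring
      rw [tsum_congr e, (h1.add (h2.mul_left _)).tsum_add h3, h1.tsum_add (h2.mul_left _),
        tsum_mul_left, hp.tsum_stepProb_coord, tsum_mul_right, hp.tsum_stepProb]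
      ring
    simp only [key, ih, mul_add, Finset.sum_add_distrib]
    rw [← Finset.sum_mul, hp.sum_steps]
    push_cast
    ring

end Kernel

/-! ### A Nash inequality from translations, and the resulting recursion. -/

section Nash

lemma sqrt_tsum_add_sq_le {ι : Type*} {A B : ι → ℝ} (hA : A.support.Finite)
    (hB : B.support.Finite) :
    √(∑' y, (A y + B y) ^ 2) ≤ √(∑' y, A y ^ 2) + √(∑' y, B y ^ 2) := by
  classical
  set T := hA.toFinset ∪ hB.toFinset with hT
  have h0 : ∀ y ∉ T, A y = 0 ∧ B y = 0 := fun y hy => by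
    simpa [hT] using hy
  rw [tsum_eq_sum (s := T) fun y hy => by simp [h0 y hy],
    tsum_eq_sum (s := T) fun y hy => by simp [h0 y hy],
    tsum_eq_sum (s := T) fun y hy => by simp [h0 y hy]]
  have hA0 : 0 ≤ ∑ y ∈ T, A y ^ 2 := Finset.sum_nonneg fun y _ => sq_nonneg _
  have hB0 : 0 ≤ ∑ y ∈ T, B y ^ 2 := Finset.sum_nonneg fun y _ => sq_nonneg _
  have hcs : ∑ y ∈ T, A y * B y ≤ √(∑ y ∈ T, A y ^ 2) * √(∑ y ∈ T, B y ^ 2) := by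
    rw [← Real.sqrt_mul hA0]
    exact Real.le_sqrt_of_sq_le (Finset.sum_mul_sq_le_sq_mul_sq T A B)
  refine Real.sqrt_le_iff.2 ⟨by positivity, ?_⟩
  have : ∑ y ∈ T, (A y + B y) ^ 2 =
      ∑ y ∈ T, A y ^ 2 + 2 * ∑ y ∈ T, A y * B y + ∑ y ∈ T, B y ^ 2 := by
    rw [Finset.mul_sum, ← Finset.sum_add_distrib, ← Finset.sum_add_distrib]
    exact Finset.sum_congr rfl fun y _ => by ring
  rw [this]
  nlinarith [Real.sq_sqrt hA0, Real.sq_sqrt hB0]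

variable {G : Type*} [AddCommGroup G]

/-- The `ℓ²` distance between `f` and its translate by `z`. -/
noncomputable def translationDist (f : G → ℝ) (z : G) : ℝ := √(∑' y, (f y - f (y - z)) ^ 2)

lemma finite_support_translate {f : G → ℝ} (hf : f.support.Finite) (z : G) :
    (Function.support fun y => f (y - z)).Finite :=
  hf.preimage fun _ _ _ _ h => sub_left_injective h

lemma translationDist_zero (f : G → ℝ) : translationDist f 0 = 0 := by
  simp [translationDist]

lemma translationDist_add_le {f : G → ℝ} (hf : f.support.Finite) (z w : G) :
    translationDist f (z + w) ≤ translationDist f z + translationDist f w := by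
  have h := sqrt_tsum_add_sq_le (A := fun y => f y - f (y - z))
    (B := fun y => f (y - z) - f (y - z - w))
    ((hf.union (finite_support_translate hf z)).subset (Function.support_sub _ _))
    (((finite_support_translate hf z).union
      (finite_support_translate (finite_support_translate hf w) z)).subset
        (Function.support_sub _ _))
  have e : ∑' y, (f (y - z) - f (y - z - w)) ^ 2 = ∑' y, (f y - f (y - w)) ^ 2 :=
    (Equiv.subRight z).tsum_eq fun y => (f y - f (y - w)) ^ 2
  rw [e] at h
  simpa [translationDist, sub_sub] using h

/-- Polarization, using that a translate has the same `ℓ²` norm. It trades the norm for a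
correlation with a translate, and correlations with many distinct translates have bounded sum. -/
lemma tsum_mul_translate {f : G → ℝ} (hf : f.support.Finite) (u : G) :
    ∑' y, f y ^ 2 = ∑' y, f y * f (y - u) + translationDist f u ^ 2 / 2 := by
  have hs : ∀ g : G → ℝ, g.support.Finite → Summable g := fun g hg =>
    summable_of_hasFiniteSupport hg
  have h1 : Summable fun y => f y * f (y - u) := hs _ (hf.subset fun y hy => left_ne_zero_of_mul hy)
  have h2 : Summable fun y => f y ^ 2 := hs _ (hf.subset fun y hy => by
    simpa using hy)
  have h3 : Summable fun y => f (y - u) ^ 2 := (Equiv.subRight u).summable_iff.2 h2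
  have e : ∑' y, f (y - u) ^ 2 = ∑' y, f y ^ 2 :=
    (Equiv.subRight u).tsum_eq fun y => f y ^ 2
  rw [translationDist, Real.sq_sqrt (tsum_nonneg fun y => sq_nonneg _)]
  have : ∑' y, (f y - f (y - u)) ^ 2 =
      ∑' y, f y ^ 2 + ∑' y, f (y - u) ^ 2 - 2 * ∑' y, f y * f (y - u) := by
    rw [← tsum_mul_left, ← h2.tsum_add h3, ← (h2.add h3).tsum_sub (h1.mul_left 2)]
    exact tsum_congr fun y => by ring
  rw [this, e]
  ring

/-- A Nash-type inequality for finitely supported probability densities on an abelian group. -/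
lemma tsum_sq_le_of_translationDist_le {f : G → ℝ} (hf : f.support.Finite) (h0 : ∀ y, 0 ≤ f y)
    (h1 : ∑' y, f y = 1) {d : ℕ} {z : Fin d → G}
    (hz : Function.Injective fun m : Fin d → ℕ => ∑ k, m k • z k) {δ : ℝ}
    (hδ : ∀ k, translationDist f (z k) ≤ δ) {R : ℕ} (hR : 1 ≤ R) :
    ∑' y, f y ^ 2 ≤ 1 / (R : ℝ) ^ d + (d * R * δ) ^ 2 / 2 := by
  classical
  have hsf : Summable f := summable_of_hasFiniteSupport hf
  -- Average the polarization identity over the `R ^ d` translates indexed by a box of side `R`.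
  set M : Finset (Fin d → ℕ) := Fintype.piFinset fun _ => Finset.range R with hM
  have hcard : (M.card : ℝ) = (R : ℝ) ^ d := by simp [hM]
  set u : (Fin d → ℕ) → G := fun m => ∑ k, m k • z k with hu
  have hdist : ∀ m ∈ M, translationDist f (u m) ^ 2 ≤ (d * R * δ) ^ 2 := fun m hm => by
    have hmk : ∀ k, (m k : ℝ) ≤ R := fun k => by
      have := Finset.mem_range.1 (Fintype.mem_piFinset.1 hm k)
      exact_mod_cast this.le
    have hn : ∀ (n : ℕ) (w : G), translationDist f (n • w) ≤ n * translationDist f w := by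
      intro n w
      induction n with
      | zero => simp [translationDist_zero]
      | succ n ih =>
        rw [succ_nsmul]
        push_cast
        linarith [translationDist_add_le hf (n • w) w]
    have hle : translationDist f (u m) ≤ ∑ k, translationDist f (m k • z k) :=
      Finset.le_sum_of_subadditive (translationDist f) (translationDist_zero f).le
        (translationDist_add_le hf) _ _
    have hle2 : ∑ k, translationDist f (m k • z k) ≤ ∑ _k : Fin d, R * δ := by
      refine Finset.sum_le_sum fun k _ => (hn _ _).trans ?_
      exact mul_le_mul (hmk k) (hδ k) (Real.sqrt_nonneg _) (by positivity)
    have h3 : translationDist f (u m) ≤ d * R * δ := by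
      refine (hle.trans hle2).trans (le_of_eq ?_)
      simp [mul_assoc]
    exact pow_le_pow_left₀ (Real.sqrt_nonneg _) h3 2
  -- By `hz` the points `y - u m` are distinct, so for each `y` the values of `f` there add up to at
  -- most the total mass `1`.
  have hsum : ∑ m ∈ M, ∑' y, f y * f (y - u m) ≤ 1 := by
    rw [← Summable.tsum_finsetSum fun m _ => summable_of_hasFiniteSupport
      (hf.subset fun y hy => left_ne_zero_of_mul hy)]
    rw [← h1]
    refine Summable.tsum_le_tsum (fun y => ?_) (summable_of_hasFiniteSupport
      (hf.subset fun y hy => ?_)) hsf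
    · rw [← Finset.mul_sum]
      refine mul_le_of_le_one_right (h0 y) ?_
      have hinj : Function.Injective fun m => y - u m := fun a b hab => hz (sub_right_injective hab)
      rw [← Finset.sum_image (f := f) (g := fun m => y - u m) hinj.injOn, ← h1]
      exact hsf.sum_le_tsum _ fun y _ => h0 y
    · simp only [Function.mem_support, ← Finset.mul_sum] at hy
      exact left_ne_zero_of_mul hy
  have htot : (R : ℝ) ^ d * ∑' y, f y ^ 2 ≤ 1 + (R : ℝ) ^ d * ((d * R * δ) ^ 2 / 2) := by
    calc (R : ℝ) ^ d * ∑' y, f y ^ 2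
        = ∑ m ∈ M, (∑' y, f y * f (y - u m) + translationDist f (u m) ^ 2 / 2) := by
          rw [Finset.sum_congr rfl fun m _ => (tsum_mul_translate hf (u m)).symm]
          simp [hcard]
      _ ≤ 1 + ∑ m ∈ M, (d * R * δ) ^ 2 / 2 := by
          rw [Finset.sum_add_distrib]
          exact add_le_add hsum (Finset.sum_le_sum fun m hm => by linarith [hdist m hm])
      _ = _ := by rw [Finset.sum_const, nsmul_eq_mul, hcard]
  have hRd : (0 : ℝ) < (R : ℝ) ^ d := by positivity
  rw [div_add' _ _ _ hRd.ne', le_div_iff₀ hRd]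
  linarith

/-- Discrete form of `a' ≤ -c a^(e+1)`, under which `a^(-e)` grows at least linearly. The induction
closes with `(1 - x) * (1 + x) ≤ 1` for `x = c * a m ^ e`. -/
lemma pow_mul_le_one_of_decay {a : ℕ → ℝ} {c : ℝ} {e : ℕ} (he : 1 ≤ e) (hc : 0 < c)
    (ha : ∀ m, 0 < a m) (h0 : a 0 ≤ 1) (hstep : ∀ m, a (m + 1) ≤ a m - c * a m ^ (e + 1))
    (m : ℕ) : a m ^ e * (1 + c * m) ≤ 1 := by
  induction m with
  | zero => simpa using pow_le_one₀ (ha 0).le h0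
  | succ m ih =>
    set A := a m ^ e with hA
    have hA0 : 0 < A := pow_pos (ha m) e
    have h1 : a (m + 1) ≤ a m * (1 - c * A) := by
      have := hstep m
      rw [pow_succ] at this
      linarith
    have hx : 0 < 1 - c * A := pos_of_mul_pos_right ((ha (m + 1)).trans_le h1) (ha m).le
    have h2 : a (m + 1) ^ e ≤ A * (1 - c * A) := by
      calc a (m + 1) ^ e ≤ (a m * (1 - c * A)) ^ e := pow_le_pow_left₀ (ha _).le h1 e
        _ = A * (1 - c * A) ^ e := mul_pow _ _ _
        _ ≤ A * (1 - c * A) := by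
          refine mul_le_mul_of_nonneg_left (pow_le_of_le_one hx.le ?_ (by omega)) hA0.le
          nlinarith
    push_cast
    calc a (m + 1) ^ e * (1 + c * (m + 1)) ≤ A * (1 - c * A) * (1 + c * (m + 1)) :=
          mul_le_mul_of_nonneg_right h2 (by positivity)
      _ = (1 - c * A) * (A * (1 + c * m) + c * A) := by ring
      _ ≤ (1 - c * A) * (1 + c * A) := mul_le_mul_of_nonneg_left (by linarith) hx.le
      _ ≤ 1 := by nlinarith [sq_nonneg (c * A)]

end Nash

/-! ### Collision probabilities: one-step decrease and lower bound. -/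

section Encounters

variable {d : ℕ} {p : Site d → Site d → ℝ}

/-- Among the differences of possible steps there are `d` independent ones. -/
lemma IsHarnessKernel.exists_independent_differences (hp : IsHarnessKernel p) :
    ∃ u w : Fin d → Site d, (∀ k, u k ∈ hp.steps) ∧ (∀ k, w k ∈ hp.steps) ∧ (∀ k, u k ≠ w k) ∧
      Function.Injective fun m : Fin d → ℕ => ∑ k, m k • (u k - w k) := by
  classical
  set φ : Site d →+ (Fin d → ℝ) := (Int.castAddHom ℝ).compLeft (Fin d) with hφ
  have hφa : ∀ (x : Site d) (k : Fin d), φ x k = x k := fun x k => rfl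
  have hne : hp.steps.Nonempty := by
    by_contra h
    have := hp.sum_steps
    simp [Finset.not_nonempty_iff_eq_empty.1 h] at this
  obtain ⟨w, hw⟩ := hne
  set T : Set (Fin d → ℝ) := (fun x => φ (x - w)) '' (hp.steps : Set (Site d)) with hT
  have hmem : ∀ x ∈ hp.steps, φ (x - w) ∈ Submodule.span ℝ T := fun x hx =>
    Submodule.subset_span ⟨x, hx, rfl⟩
  -- Centering is essential here: the mean of `x - w` is `-w`, so the differences already span `w`,
  -- and with it every step.
  have hwT : φ w ∈ Submodule.span ℝ T := by
    have h1 : ∑ x ∈ hp.steps, p 0 x • φ (x - w) ∈ Submodule.span ℝ T :=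
      Submodule.sum_mem _ fun x hx => Submodule.smul_mem _ _ (hmem x hx)
    have h2 : ∑ x ∈ hp.steps, p 0 x • φ (x - w) = - φ w := by
      ext k
      simp only [Finset.sum_apply, Pi.smul_apply, Pi.neg_apply, map_sub, Pi.sub_apply, hφa,
        smul_eq_mul, mul_sub, Finset.sum_sub_distrib, hp.sum_steps_mul k, ← Finset.sum_mul,
        hp.sum_steps]
      ring
    rw [h2] at h1
    simpa using h1
  have hall : ∀ x : Site d, φ x ∈ Submodule.span ℝ T := fun x => by
    have hx : x ∈ AddSubgroup.closure {j : Site d | p 0 j ≠ 0} := by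
      rw [hp.generates]; trivial
    have hle : AddSubgroup.closure {j : Site d | p 0 j ≠ 0} ≤
        (Submodule.span ℝ T).toAddSubgroup.comap φ := by
      rw [AddSubgroup.closure_le]
      intro y hy
      have := Submodule.add_mem _ (hmem y (hp.mem_steps.2 hy)) hwT
      rw [← map_add, sub_add_cancel] at this
      exact this
    exact hle hx
  have htop : Submodule.span ℝ T = ⊤ := by
    rw [eq_top_iff, ← (Pi.basisFun ℝ (Fin d)).span_eq, Submodule.span_le]
    rintro _ ⟨k, rfl⟩
    have : φ (Pi.single k 1) = Pi.basisFun ℝ (Fin d) k := by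
      ext l
      rw [hφa, Pi.basisFun_apply]
      by_cases h : l = k
      · subst h; simp
      · simp [h]
    rw [← this]
    exact hall _
  obtain ⟨b, hbT, hbs, hbl⟩ := exists_linearIndependent ℝ T
  have hB : ⊤ ≤ Submodule.span ℝ (Set.range ((↑) : b → Fin d → ℝ)) := by
    rw [Subtype.range_coe, hbs, htop]
  let e : Fin d ≃ b := (Pi.basisFun ℝ (Fin d)).indexEquiv (Module.Basis.mk hbl hB)
  have hch : ∀ k : Fin d, ∃ x ∈ hp.steps, φ (x - w) = e k := fun k => by
    obtain ⟨x, hx, h⟩ := hbT (e k).2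
    exact ⟨x, hx, h⟩
  choose u hu hue using hch
  have hli : LinearIndependent ℝ fun k => ((e k : b) : Fin d → ℝ) := hbl.comp e e.injective
  refine ⟨u, fun _ => w, hu, fun _ => hw, fun k hk => ?_, fun m n hmn => ?_⟩
  · have h1 := hue k
    rw [hk, sub_self, map_zero] at h1
    exact hli.ne_zero k h1.symm
  have h1 := congrArg φ hmn
  simp only [map_sum, map_nsmul, hue] at h1
  have h2 : ∑ k, ((m k : ℝ) - n k) • ((e k : b) : Fin d → ℝ) = 0 := by
    simp only [sub_smul, Finset.sum_sub_distrib, Nat.cast_smul_eq_nsmul, h1, sub_self]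
  ext k
  have h3 := Fintype.linearIndependent_iff.1 hli _ h2 k
  exact_mod_cast sub_eq_zero.1 h3

/-- The variance of `v` under the weights `q` is at least the contribution of the two atoms `a` and
`b`, wherever the mean lies. -/
lemma sq_sum_add_mul_sq_sub_le {ι : Type*} {s : Finset ι} {q v : ι → ℝ} (hq : ∀ i ∈ s, 0 ≤ q i)
    (h1 : ∑ i ∈ s, q i = 1) {a b : ι} (ha : a ∈ s) (hb : b ∈ s) (hab : a ≠ b) :
    (∑ i ∈ s, q i * v i) ^ 2 + q a * q b * (v a - v b) ^ 2 ≤ ∑ i ∈ s, q i * v i ^ 2 := by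
  classical
  set m := ∑ i ∈ s, q i * v i with hm
  have hvar : ∑ i ∈ s, q i * (v i - m) ^ 2 = ∑ i ∈ s, q i * v i ^ 2 - m ^ 2 := by
    have : ∀ i ∈ s, q i * (v i - m) ^ 2 = q i * v i ^ 2 - 2 * m * (q i * v i) + m ^ 2 * q i :=
      fun i _ => by ring
    rw [Finset.sum_congr rfl this, Finset.sum_add_distrib, Finset.sum_sub_distrib,
      ← Finset.mul_sum, ← Finset.mul_sum, h1, ← hm]
    ring
  have hsub : ({a, b} : Finset ι) ⊆ s := by
    intro x hx
    rcases Finset.mem_insert.1 hx with rfl | hx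
    · exact ha
    · rwa [Finset.mem_singleton.1 hx]
  have h2 : q a * (v a - m) ^ 2 + q b * (v b - m) ^ 2 ≤ ∑ i ∈ s, q i * (v i - m) ^ 2 := by
    rw [← Finset.sum_pair hab (f := fun i => q i * (v i - m) ^ 2)]
    exact Finset.sum_le_sum_of_subset_of_nonneg hsub fun i hi _ =>
      mul_nonneg (hq i hi) (sq_nonneg _)
  have h3 : q a + q b ≤ 1 := by
    rw [← h1, ← Finset.sum_pair hab]
    exact Finset.sum_le_sum_of_subset_of_nonneg hsub fun i hi _ => hq i hi
  have hqa := hq a ha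
  have hqb := hq b hb
  have h4 : q a * q b * (v a - v b) ^ 2 ≤ q a * (v a - m) ^ 2 + q b * (v b - m) ^ 2 := by
    have e : q a * (v a - m) ^ 2 + q b * (v b - m) ^ 2 - q a * q b * (v a - v b) ^ 2 =
        q a * (1 - q a - q b) * (v a - m) ^ 2 + q b * (1 - q a - q b) * (v b - m) ^ 2 +
          (q a * (v a - m) + q b * (v b - m)) ^ 2 := by ring
    have : 0 ≤ 1 - q a - q b := by linarith
    have := mul_nonneg (mul_nonneg hqa this) (sq_nonneg (v a - m))
    have := mul_nonneg (mul_nonneg hqb ‹0 ≤ 1 - q a - q b›) (sq_nonneg (v b - m))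
    linarith [sq_nonneg (q a * (v a - m) + q b * (v b - m))]
  linarith

/-- The collision probability `∑_j p_m(j)²` of two independent walks at time `m`. -/
noncomputable def collision (p : Site d → Site d → ℝ) (m : ℕ) : ℝ := ∑' j, stepProb p m 0 j ^ 2

lemma IsHarnessKernel.summable_stepProb_sq (hp : IsHarnessKernel p) (m : ℕ) :
    Summable fun y => stepProb p m 0 y ^ 2 := by
  simpa [sq] using hp.summable_stepProb_mul m (stepProb p m 0)

lemma collision_zero : collision p 0 = 1 := by
  simp [collision, sq, stepProb]

/-- `p_{m+1}(y)` is the average of the `p_m(y - x)` over steps `x`. Squaring an average loses the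
variance, which the pair `u`, `w` bounds from below; then sum over `y`. -/
lemma IsHarnessKernel.collision_succ_add_le (hp : IsHarnessKernel p) (m : ℕ) {u w : Site d}
    (hu : u ∈ hp.steps) (hw : w ∈ hp.steps) (huw : u ≠ w) :
    collision p (m + 1) + p 0 u * p 0 w * translationDist (stepProb p m 0) (u - w) ^ 2 ≤
      collision p m := by
  have hf := hp.finite_support_stepProb m
  have hs := hp.summable_stepProb_sq m
  have hshift : ∀ x : Site d, HasSum (fun y => stepProb p m 0 (y - x) ^ 2) (collision p m) :=
    fun x => (Equiv.subRight x).hasSum_iff.2 hs.hasSum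
  have h1 : HasSum (fun y => ∑ x ∈ hp.steps, p 0 x * stepProb p m 0 (y - x) ^ 2)
      (collision p m) := by
    have := hasSum_sum fun x (_ : x ∈ hp.steps) => (hshift x).mul_left (p 0 x)
    rwa [← Finset.sum_mul, hp.sum_steps, one_mul] at this
  have h2 : ∑' y, (stepProb p m 0 (y - u) - stepProb p m 0 (y - w)) ^ 2 =
      translationDist (stepProb p m 0) (u - w) ^ 2 := by
    rw [translationDist, Real.sq_sqrt (tsum_nonneg fun _ => sq_nonneg _),
      ← (Equiv.subRight w).tsum_eq fun y => (stepProb p m 0 y - stepProb p m 0 (y - (u - w))) ^ 2]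
    refine tsum_congr fun y => ?_
    rw [Equiv.subRight_apply, sub_sub, add_sub_cancel]
    ring
  have hsd : Summable fun y => (stepProb p m 0 (y - u) - stepProb p m 0 (y - w)) ^ 2 := by
    refine summable_of_hasFiniteSupport (((finite_support_translate hf u).union
      (finite_support_translate hf w)).subset fun y hy => ?_)
    refine Function.support_sub (fun y => stepProb p m 0 (y - u))
      (fun y => stepProb p m 0 (y - w)) ?_
    simpa using hy
  rw [← h2, ← tsum_mul_left, collision, ← (hp.summable_stepProb_sq (m + 1)).tsum_add
    (hsd.mul_left _), ← h1.tsum_eq]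
  refine Summable.tsum_le_tsum (fun y => ?_)
    ((hp.summable_stepProb_sq (m + 1)).add (hsd.mul_left _)) h1.summable
  rw [hp.stepProb_succ]
  exact sq_sum_add_mul_sq_sub_le (q := p 0) (v := fun x => stepProb p m 0 (y - x))
    (fun x _ => hp.nonneg 0 x) hp.sum_steps hu hw huw

/-- Chebyshev's inequality gives the lower bound on the collision probability. -/
lemma IsHarnessKernel.exists_le_collision (hp : IsHarnessKernel p) :
    ∃ c : ℝ, 0 < c ∧ ∀ m : ℕ, c / √(m + 1) ^ d ≤ collision p m := by
  classical
  set V : ℝ := ∑ k : Fin d, ∑ x ∈ hp.steps, p 0 x * (x k : ℝ) ^ 2 with hV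
  have hV0 : 0 ≤ V := Finset.sum_nonneg fun k _ => Finset.sum_nonneg fun x _ =>
    mul_nonneg (hp.nonneg _ _) (sq_nonneg _)
  set K : ℝ := 2 * √(2 * V) + 1 with hK
  have hK0 : 0 < K := by positivity
  refine ⟨1 / (4 * K ^ d), by positivity, fun m => ?_⟩
  set f := stepProb p m 0 with hf
  have hf0 : ∀ y, 0 ≤ f y := hp.stepProb_nonneg m
  have hfs : Summable f := summable_of_hasFiniteSupport (hp.finite_support_stepProb m)
  -- The second moment of `p_m` is `m * V`, so the points outside the box of radius `L`, having a
  -- coordinate of size at least `L + 1`, carry mass at most `1/2`.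
  set L : ℕ := ⌊√(2 * (m * V))⌋₊ with hL
  have hL1 : 2 * (m * V) ≤ ((L : ℝ) + 1) ^ 2 := by
    have h := (Nat.lt_floor_add_one (√(2 * (m * V)))).le
    calc 2 * (m * V) = √(2 * (m * V)) ^ 2 := (Real.sq_sqrt (by positivity)).symm
      _ ≤ _ := pow_le_pow_left₀ (Real.sqrt_nonneg _) h 2
  have hL2 : 2 * (L : ℝ) + 1 ≤ K * √(m + 1) := by
    have h : (L : ℝ) ≤ √(2 * (m * V)) := Nat.floor_le (Real.sqrt_nonneg _)
    have h' : √(2 * (m * V)) ≤ √(2 * V) * √(m + 1) := by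
      rw [← Real.sqrt_mul (by positivity)]
      exact Real.sqrt_le_sqrt (by nlinarith)
    have h'' : 1 ≤ √((m : ℝ) + 1) := Real.one_le_sqrt.2 (by linarith [Nat.cast_nonneg (α := ℝ) m])
    rw [hK]
    nlinarith
  set B : Finset (Site d) := Fintype.piFinset fun _ => Finset.Icc (-(L : ℤ)) L with hB
  have hBcard : (B.card : ℝ) = (2 * (L : ℝ) + 1) ^ d := by
    have : ((L : ℤ) + 1 + (L : ℤ)).toNat = 2 * L + 1 := by omega
    simp [hB, this]
  have hmom : ∑' y, f y * ∑ k, (y k : ℝ) ^ 2 = m * V := by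
    simp only [Finset.mul_sum]
    rw [Summable.tsum_finsetSum fun k _ => hp.summable_stepProb_mul m fun y => (y k : ℝ) ^ 2]
    simp only [hp.tsum_stepProb_coord_sq, hV, Finset.mul_sum]
  have hmass : 1 / 2 ≤ ∑ y ∈ B, f y := by
    have hsB : Summable fun y => f y * (if y ∈ B then (1 : ℝ) else 0) :=
      hp.summable_stepProb_mul m _
    have hsM := (hp.summable_stepProb_mul m fun y => ∑ k, (y k : ℝ) ^ 2)
    have hB' : ∑' y, f y * (if y ∈ B then (1 : ℝ) else 0) = ∑ y ∈ B, f y := by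
      rw [tsum_eq_sum (s := B) fun y hy => by simp [hy]]
      exact Finset.sum_congr rfl fun y hy => by simp [hy]
    have hpt : ∀ y, f y ≤ f y * (if y ∈ B then (1 : ℝ) else 0) +
        (((L : ℝ) + 1) ^ 2)⁻¹ * (f y * ∑ k, (y k : ℝ) ^ 2) := fun y => by
      by_cases hy : y ∈ B
      · have : 0 ≤ ∑ k, (y k : ℝ) ^ 2 := Finset.sum_nonneg fun _ _ => sq_nonneg _
        have := mul_nonneg (hf0 y) this
        simp only [hy, if_true, mul_one]
        have : 0 ≤ (((L : ℝ) + 1) ^ 2)⁻¹ * (f y * ∑ k, (y k : ℝ) ^ 2) := by positivity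
        linarith
      · obtain ⟨k, hk⟩ : ∃ k, y k ∉ Finset.Icc (-(L : ℤ)) L := by
          by_contra h
          push Not at h
          exact hy (Fintype.mem_piFinset.2 h)
        have hk' : (L : ℤ) + 1 ≤ |y k| := by
          rw [Finset.mem_Icc, ← abs_le] at hk
          omega
        have hk2 : ((L : ℝ) + 1) ^ 2 ≤ (y k : ℝ) ^ 2 := by
          rw [← sq_abs (y k : ℝ)]
          refine pow_le_pow_left₀ (by positivity) ?_ 2
          exact_mod_cast hk'
        have hk3 : ((L : ℝ) + 1) ^ 2 ≤ ∑ k, (y k : ℝ) ^ 2 :=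
          hk2.trans (Finset.single_le_sum (f := fun k => (y k : ℝ) ^ 2)
            (fun _ _ => sq_nonneg _) (Finset.mem_univ k))
        simp only [hy, if_false, mul_zero, zero_add]
        rw [inv_mul_eq_div, le_div_iff₀ (by positivity)]
        exact mul_le_mul_of_nonneg_left hk3 (hf0 y)
    have h1 := Summable.tsum_le_tsum hpt hfs (hsB.add (hsM.mul_left _))
    rw [hsB.tsum_add (hsM.mul_left _), tsum_mul_left, hmom, hB', hf, hp.tsum_stepProb,
      inv_mul_eq_div] at h1
    have h2 : m * V / ((L : ℝ) + 1) ^ 2 ≤ 1 / 2 := by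
      rw [div_le_div_iff₀ (by positivity) (by norm_num)]
      linarith
    linarith
  have hcs : (∑ y ∈ B, f y) ^ 2 ≤ B.card * collision p m := by
    refine sq_sum_le_card_mul_sum_sq.trans (mul_le_mul_of_nonneg_left ?_ (by positivity))
    exact (hp.summable_stepProb_sq m).sum_le_tsum _ fun y _ => sq_nonneg _
  have hcol : 0 ≤ collision p m := tsum_nonneg fun y => sq_nonneg _
  have hfin : 1 / 4 ≤ (K * √(m + 1)) ^ d * collision p m := by
    calc (1 / 4 : ℝ) = (1 / 2) ^ 2 := by norm_num
      _ ≤ (∑ y ∈ B, f y) ^ 2 := pow_le_pow_left₀ (by norm_num) hmass 2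
      _ ≤ B.card * collision p m := hcs
      _ ≤ _ := by
        rw [hBcard]
        exact mul_le_mul_of_nonneg_right (pow_le_pow_left₀ (by positivity) hL2 d) hcol
  have h1 : (0 : ℝ) < √(m + 1) := Real.sqrt_pos.2 (by positivity)
  rw [div_div, div_le_iff₀ (by positivity)]
  rw [mul_pow] at hfin
  linarith

lemma IsHarnessKernel.collision_pos (hp : IsHarnessKernel p) (m : ℕ) : 0 < collision p m := by
  obtain ⟨c, hc, h⟩ := hp.exists_le_collision
  have h1 : (0 : ℝ) < √(m + 1) := Real.sqrt_pos.2 (by positivity)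
  exact lt_of_lt_of_le (by positivity) (h m)

end Encounters

/-! ### Decay of collision probabilities and growth of encounters. -/

section Asymptotics

variable {d : ℕ} {p : Site d → Site d → ℝ}

lemma IsHarnessKernel.collision_succ_le (hp : IsHarnessKernel p) (hd : 1 ≤ d) (m : ℕ) :
    collision p (m + 1) ≤ collision p m := by
  obtain ⟨u, w, hu, hw, hne, -⟩ := hp.exists_independent_differences
  have h1 := hp.collision_succ_add_le m (hu ⟨0, hd⟩) (hw ⟨0, hd⟩) (hne ⟨0, hd⟩)
  have := mul_nonneg (mul_nonneg (hp.nonneg 0 (u ⟨0, hd⟩)) (hp.nonneg 0 (w ⟨0, hd⟩)))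
    (sq_nonneg (translationDist (stepProb p m 0) (u ⟨0, hd⟩ - w ⟨0, hd⟩)))
  linarith

/-- For every side length `R`, the Nash inequality bounds the collision probability in terms of its
own decrease. -/
lemma IsHarnessKernel.exists_collision_le (hp : IsHarnessKernel p) (hd : 1 ≤ d) :
    ∃ ρ : ℝ, 0 < ρ ∧ ∀ m R : ℕ, 1 ≤ R → collision p m ≤
      1 / (R : ℝ) ^ d + (d * R) ^ 2 * ((collision p m - collision p (m + 1)) / ρ) / 2 := by
  obtain ⟨u, w, hu, hw, hne, hinj⟩ := hp.exists_independent_differences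
  have hpos : ∀ x ∈ hp.steps, 0 < p 0 x := fun x hx =>
    lt_of_le_of_ne (hp.nonneg _ _) (hp.mem_steps.1 hx).symm
  -- A common positive lower bound for finitely many positive numbers: any sufficiently small
  -- positive real.
  obtain ⟨ρ, hρk, hρ⟩ : ∃ ρ : ℝ, (∀ k, ρ ≤ p 0 (u k) * p 0 (w k)) ∧ ρ ∈ Set.Ioi 0 :=
    ((Filter.eventually_all.2 fun k => nhdsWithin_le_nhds
      (eventually_le_nhds (mul_pos (hpos _ (hu k)) (hpos _ (hw k))))).and
        (self_mem_nhdsWithin (a := (0 : ℝ)) (s := Set.Ioi 0))).exists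
  rw [Set.mem_Ioi] at hρ
  refine ⟨ρ, hρ, fun m R hR => ?_⟩
  set Δ := (collision p m - collision p (m + 1)) / ρ with hΔ
  have hΔ0 : 0 ≤ Δ := div_nonneg (sub_nonneg.2 (hp.collision_succ_le hd m)) hρ.le
  have hdist : ∀ k, translationDist (stepProb p m 0) (u k - w k) ≤ √Δ := fun k => by
    refine Real.le_sqrt_of_sq_le ?_
    rw [hΔ, le_div_iff₀ hρ]
    have h1 := hp.collision_succ_add_le m (hu k) (hw k) (hne k)
    have h2 := mul_le_mul_of_nonneg_right (hρk k)
      (sq_nonneg (translationDist (stepProb p m 0) (u k - w k)))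
    linarith
  have h := tsum_sq_le_of_translationDist_le (hp.finite_support_stepProb m) (hp.stepProb_nonneg m)
    (hp.tsum_stepProb m) hinj hdist hR
  rwa [mul_pow _ (√Δ), Real.sq_sqrt hΔ0] at h

lemma IsHarnessKernel.collision_le_one (hp : IsHarnessKernel p) (hd : 1 ≤ d) (m : ℕ) :
    collision p m ≤ 1 := by
  induction m with
  | zero => exact collision_zero.le
  | succ m ih => exact (hp.collision_succ_le hd m).trans ih

/-- If side lengths `R` with `R ^ d ≥ 2 / a` and `R ^ 2 ≤ 9 / a ^ e` exist for all `a ≤ 1`, then the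
collision probability decays as `m ^ (-1 / e)`. -/
lemma IsHarnessKernel.exists_collision_pow_le (hp : IsHarnessKernel p) (hd : 1 ≤ d) {e : ℕ}
    (he : 1 ≤ e) (hR : ∀ a : ℝ, 0 < a → a ≤ 1 →
      ∃ R : ℕ, 2 / a ≤ (R : ℝ) ^ d ∧ (R : ℝ) ^ 2 ≤ 9 / a ^ e) :
    ∃ K : ℝ, 0 < K ∧ ∀ m : ℕ, collision p m ^ e ≤ K / (m + 1) := by
  obtain ⟨ρ, hρ, hN⟩ := hp.exists_collision_le hd
  have hd0 : (0 : ℝ) < d := by exact_mod_cast hd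
  set c : ℝ := ρ / (9 * d ^ 2) with hc
  have hc0 : 0 < c := by positivity
  have hstep : ∀ m, collision p (m + 1) ≤ collision p m - c * collision p m ^ (e + 1) := by
    intro m
    have ha := hp.collision_pos m
    obtain ⟨R, hR1, hR2⟩ := hR _ ha (hp.collision_le_one hd m)
    set a := collision p m with hadef
    set D := a - collision p (m + 1) with hD
    have hD0 : 0 ≤ D := sub_nonneg.2 (hp.collision_succ_le hd m)
    have hRpos : 1 ≤ R := by
      rcases Nat.eq_zero_or_pos R with rfl | h
      · have h0 : (0 : ℝ) < 2 / a := by positivity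
        simp [zero_pow (by omega : d ≠ 0)] at hR1
        linarith
      · exact h
    have h1 := hN m R hRpos
    -- The lower bound on `R ^ d` lets the first Nash term be absorbed in `a`; what remains gives a
    -- decrease of order `a ^ (e + 1)`.
    have h2 : 1 / (R : ℝ) ^ d ≤ a / 2 := by
      rw [div_le_iff₀ ha] at hR1
      rw [div_le_div_iff₀ (by positivity) (by norm_num)]
      linarith
    have h3 : (d * R : ℝ) ^ 2 * (D / ρ) ≤ d ^ 2 * (9 / a ^ e) * (D / ρ) := by
      rw [mul_pow]
      exact mul_le_mul_of_nonneg_right (mul_le_mul_of_nonneg_left hR2 (by positivity))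
        (by positivity)
    have h4 : a ≤ d ^ 2 * (9 / a ^ e) * (D / ρ) := by
      have : a ≤ 1 / (R : ℝ) ^ d + (d * R) ^ 2 * (D / ρ) / 2 := h1
      linarith
    have h5 : c * a ^ (e + 1) ≤ D := by
      have hae : 0 < a ^ e := by positivity
      have e1 : (d : ℝ) ^ 2 * (9 / a ^ e) * (D / ρ) = D / (c * a ^ e) := by
        rw [hc]; field_simp
      rw [e1, le_div_iff₀ (by positivity)] at h4
      calc c * a ^ (e + 1) = a * (c * a ^ e) := by ring
        _ ≤ D := h4
    linarith
  have hdec := pow_mul_le_one_of_decay he hc0 hp.collision_pos (collision_zero (p := p)).le hstep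
  refine ⟨1 + 1 / c, by positivity, fun m => ?_⟩
  rw [le_div_iff₀ (by positivity)]
  have h0 : 0 < collision p m ^ e := pow_pos (hp.collision_pos m) e
  have h := hdec m
  have h1 : collision p m ^ e ≤ 1 := pow_le_one₀ (hp.collision_pos m).le (hp.collision_le_one hd m)
  have h2 : collision p m ^ e * m ≤ 1 / c := by
    rw [le_div_iff₀ hc0]; nlinarith
  linarith

lemma encounters_eq_sum (n : ℕ) : encounters p n = ∑ r ∈ Finset.range n, collision p r := rfl

lemma IsHarnessKernel.encounters_mono (hp : IsHarnessKernel p) : Monotone (encounters p) := by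
  refine monotone_nat_of_le_succ fun n => ?_
  rw [encounters_eq_sum, encounters_eq_sum, Finset.sum_range_succ]
  linarith [hp.collision_pos n]

lemma IsHarnessKernel.one_le_encounters (hp : IsHarnessKernel p) {n : ℕ} (hn : 1 ≤ n) :
    1 ≤ encounters p n := by
  refine le_trans ?_ (hp.encounters_mono hn)
  simp [encounters_eq_sum, collision_zero]

/-- Here `e = 2`, so collisions have order `1 / √(m + 1)`, which is comparable to the increment `√(m
+ 1) - √m`; the sum telescopes. -/
lemma IsHarnessKernel.encounters_one_dim {p : Site 1 → Site 1 → ℝ} (hp : IsHarnessKernel p) :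
    ∃ c C : ℝ, 0 < c ∧ 0 < C ∧ ∀ n : ℕ, c * √n ≤ encounters p n ∧ encounters p n ≤ C * √n := by
  obtain ⟨c, hc, hlow⟩ := hp.exists_le_collision
  obtain ⟨K, hK, hup⟩ := hp.exists_collision_pow_le (e := 2) le_rfl (by norm_num) fun a ha ha1 => by
    refine ⟨⌈2 / a⌉₊, by simpa using Nat.le_ceil (2 / a), ?_⟩
    have h1 : (⌈2 / a⌉₊ : ℝ) ≤ 3 / a := by
      have h := (Nat.ceil_lt_add_one (show 0 ≤ 2 / a by positivity)).le
      have : 1 ≤ 1 / a := by rwa [le_div_iff₀ ha, one_mul]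
      calc (⌈2 / a⌉₊ : ℝ) ≤ 2 / a + 1 / a := by linarith
        _ = 3 / a := by ring
    calc (⌈2 / a⌉₊ : ℝ) ^ 2 ≤ (3 / a) ^ 2 := pow_le_pow_left₀ (by positivity) h1 2
      _ = 9 / a ^ 2 := by rw [div_pow]; norm_num
  refine ⟨c, 2 * √K, hc, by positivity, fun n => ?_⟩
  have hs : ∀ n : ℕ, (0 : ℝ) < √(n + 1) := fun n => Real.sqrt_pos.2 (by positivity)
  have hq : ∀ n : ℕ, √((n : ℝ) + 1) ^ 2 = n + 1 := fun n => Real.sq_sqrt (by positivity)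
  have hq' : ∀ n : ℕ, √(n : ℝ) ^ 2 = n := fun n => Real.sq_sqrt (by positivity)
  rw [encounters_eq_sum]
  induction n with
  | zero => simp
  | succ n ih =>
    have hmono : √(n : ℝ) ≤ √((n : ℝ) + 1) := Real.sqrt_le_sqrt (by linarith)
    have hn0 := Real.sqrt_nonneg (n : ℝ)
    rw [Finset.sum_range_succ]
    push_cast
    constructor
    · have h1 : √((n : ℝ) + 1) - √n ≤ 1 / √(n + 1) := by
        rw [le_div_iff₀ (hs n)]
        nlinarith [hq n, hq' n]
      have h2 := hlow n
      rw [pow_one, div_eq_mul_one_div] at h2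
      nlinarith [ih.1]
    · have h1 : 1 / √((n : ℝ) + 1) ≤ 2 * (√(n + 1) - √n) := by
        rw [div_le_iff₀ (hs n)]
        nlinarith [hq n, hq' n]
      have h2 : collision p n ≤ √K * (1 / √(n + 1)) := by
        rw [mul_one_div, ← Real.sqrt_div hK.le]
        exact Real.le_sqrt_of_sq_le (hup n)
      have h3 := mul_le_mul_of_nonneg_left h1 (Real.sqrt_nonneg K)
      linarith [ih.2]

lemma sum_inv_eq_harmonic (n : ℕ) :
    ∑ r ∈ Finset.range n, (1 : ℝ) / (r + 1) = (harmonic n : ℝ) := by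
  simp [harmonic]

/-- Here `e = 1`, so collisions have order `1 / (m + 1)` and the sum is compared with the harmonic
numbers. -/
lemma IsHarnessKernel.encounters_two_dim {p : Site 2 → Site 2 → ℝ} (hp : IsHarnessKernel p) :
    ∃ c C : ℝ, 0 < c ∧ 0 < C ∧ (∀ n : ℕ, c * Real.log n ≤ encounters p n) ∧
      ∀ n : ℕ, 2 ≤ n → encounters p n ≤ C * Real.log n := by
  obtain ⟨c, hc, hlow⟩ := hp.exists_le_collision
  obtain ⟨K, hK, hup⟩ := hp.exists_collision_pow_le (e := 1) (by norm_num) le_rfl fun a ha ha1 => by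
    refine ⟨⌈√(2 / a)⌉₊, ?_, ?_⟩
    · calc 2 / a = √(2 / a) ^ 2 := (Real.sq_sqrt (by positivity)).symm
        _ ≤ _ := pow_le_pow_left₀ (Real.sqrt_nonneg _) (Nat.le_ceil _) 2
    · have h := (Nat.ceil_lt_add_one (Real.sqrt_nonneg (2 / a))).le
      have h1 : (⌈√(2 / a)⌉₊ : ℝ) ^ 2 ≤ (√(2 / a) + 1) ^ 2 :=
        pow_le_pow_left₀ (by positivity) h 2
      have h2 : √(2 / a) ^ 2 = 2 / a := Real.sq_sqrt (by positivity)
      have h3 : 1 ≤ 1 / a := by rwa [le_div_iff₀ ha, one_mul]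
      have h4 : 9 / a ^ 1 = 2 * (2 / a) + 5 * (1 / a) := by rw [pow_one]; ring
      rw [h4]
      nlinarith [sq_nonneg (√(2 / a) - 1)]
  have hlog2 : 0 < Real.log 2 := Real.log_pos (by norm_num)
  refine ⟨c, K * (1 / Real.log 2 + 1), hc, by positivity, fun n => ?_, fun n hn => ?_⟩
  · rcases Nat.eq_zero_or_pos n with rfl | hn
    · simp [encounters_eq_sum]
    have h1 : c * (harmonic n : ℝ) ≤ encounters p n := by
      rw [← sum_inv_eq_harmonic, Finset.mul_sum, encounters_eq_sum]
      refine Finset.sum_le_sum fun r _ => ?_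
      have := hlow r
      rwa [Real.sq_sqrt (by positivity), div_eq_mul_one_div] at this
    have h2 : Real.log n ≤ harmonic n := by
      refine le_trans (Real.log_le_log (by exact_mod_cast hn) ?_) (log_add_one_le_harmonic n)
      push_cast
      linarith
    exact (mul_le_mul_of_nonneg_left h2 hc.le).trans h1
  · have h1 : encounters p n ≤ K * (harmonic n : ℝ) := by
      rw [← sum_inv_eq_harmonic, Finset.mul_sum, encounters_eq_sum]
      refine Finset.sum_le_sum fun r _ => ?_
      have := hup r
      rwa [pow_one, div_eq_mul_one_div] at this
    have h2 : Real.log 2 ≤ Real.log n := Real.log_le_log (by norm_num) (by exact_mod_cast hn)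
    have h3 : 1 ≤ 1 / Real.log 2 * Real.log n := by
      rw [one_div, inv_mul_eq_div, le_div_iff₀ hlog2]; linarith
    refine h1.trans ?_
    rw [mul_assoc]
    exact mul_le_mul_of_nonneg_left (by linarith [harmonic_le_one_add_log n]) hK.le

/-- In dimension at most two, encounters are at least logarithmic. -/
lemma IsHarnessKernel.exists_log_le_encounters (hp : IsHarnessKernel p) (hd1 : 1 ≤ d)
    (hd2 : d ≤ 2) : ∃ κ : ℝ, 0 < κ ∧ ∀ n : ℕ, Real.log n ≤ κ * encounters p n := by
  obtain rfl | rfl : d = 1 ∨ d = 2 := by omega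
  · obtain ⟨c, C, hc, -, h⟩ := hp.encounters_one_dim
    refine ⟨2 / c, by positivity, fun n => ?_⟩
    have h1 := (h n).1
    have h2 : Real.log n ≤ 2 * √n := by
      have h3 := Real.log_le_self (Real.sqrt_nonneg (n : ℝ))
      rw [Real.log_sqrt (by positivity)] at h3
      linarith
    rw [div_mul_eq_mul_div, le_div_iff₀ hc]
    nlinarith
  · obtain ⟨c, C, hc, -, h, -⟩ := hp.encounters_two_dim
    refine ⟨1 / c, by positivity, fun n => ?_⟩
    rw [one_div, inv_mul_eq_div, le_div_iff₀ hc]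
    linarith [h n]

end Asymptotics

/-! ### Exponential moments and variance of the noise. -/

section NoiseLaw

variable {F : Measure ℝ}

lemma IsNoiseLaw.integrable_comp_neg (hF : IsNoiseLaw F) {g : ℝ → ℝ} (hg : Integrable g F) :
    Integrable (fun x => g (-x)) F := by
  have h : Integrable g (F.map fun x : ℝ => -x) := by rwa [hF.symmetric]
  exact h.comp_measurable measurable_neg

lemma IsNoiseLaw.integral_id (hF : IsNoiseLaw F) : ∫ x, x ∂F = 0 := by
  have h : ∫ x, x ∂(F.map fun x : ℝ => -x) = ∫ x, -x ∂F :=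
    integral_map measurable_neg.aemeasurable measurable_id.aestronglyMeasurable
  rw [hF.symmetric, integral_neg] at h
  linarith

/-- Layer-cake formula. Half the tail rate, `b' / 2`, turns the exponential tail into `b * t ^
(-2)`, integrable at infinity. -/
lemma exists_integrable_exp_of_mem_LMinus [IsProbabilityMeasure F] (hF1 : F ∈ LMinus 1) :
    ∃ t : ℝ, 0 < t ∧ Integrable (fun x => Real.exp (t * x)) F := by
  obtain ⟨b, hb, b', hb', htail⟩ := hF1
  refine ⟨b' / 2, by positivity, ⟨by fun_prop, ?_⟩⟩
  rw [hasFiniteIntegral_iff_ofReal (Filter.Eventually.of_forall fun x => (Real.exp_pos _).le),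
    lintegral_eq_lintegral_meas_lt F (Filter.Eventually.of_forall fun x => (Real.exp_pos _).le)
      (by fun_prop),
    ← Set.Ioc_union_Ioi_eq_Ioi (zero_le_one' ℝ)]
  refine (lintegral_union_le _ _ _).trans_lt (ENNReal.add_lt_top.2 ⟨?_, ?_⟩)
  · calc ∫⁻ t in Set.Ioc (0 : ℝ) 1, F {a | t < Real.exp (b' / 2 * a)}
        ≤ ∫⁻ _ in Set.Ioc (0 : ℝ) 1, 1 := lintegral_mono fun t => prob_le_one
      _ < ⊤ := by simp
  · have hint : IntegrableOn (fun t : ℝ => b * t ^ (-2 : ℝ)) (Set.Ioi 1) :=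
      (integrableOn_Ioi_rpow_of_lt (by norm_num) one_pos).const_mul b
    refine lt_of_le_of_lt (setLIntegral_mono' measurableSet_Ioi fun t ht => ?_)
      hint.lintegral_lt_top
    rw [Set.mem_Ioi] at ht
    have hlog : 0 < Real.log t := Real.log_pos ht
    have ht0 : 0 < t := by linarith
    have hset : {a : ℝ | t < Real.exp (b' / 2 * a)} = Set.Ioi (2 * Real.log t / b') := by
      ext a
      rw [Set.mem_ofPred_eq, Set.mem_Ioi, ← Real.log_lt_iff_lt_exp ht0, div_lt_iff₀ hb']
      constructor <;> intro h <;> linarith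
    have h := htail (2 * Real.log t / b') (by positivity)
    rw [hset, ← ofReal_measureReal]
    refine ENNReal.ofReal_le_ofReal (h.trans (le_of_eq ?_))
    rw [Real.rpow_def_of_pos ht0, Real.rpow_one]
    congr 2
    field_simp

lemma exp_le_one_add_add_sq_mul_exp_abs (x : ℝ) :
    Real.exp x ≤ 1 + x + x ^ 2 * Real.exp |x| := by
  have h := Complex.norm_exp_sub_sum_le_norm_mul_exp x 2
  simp only [Finset.sum_range_succ, Finset.sum_range_zero, zero_add, pow_zero, pow_one,
    Nat.factorial_zero, Nat.factorial_one, Nat.cast_one, div_one] at h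
  rw [← Complex.ofReal_exp, ← Complex.ofReal_one, ← Complex.ofReal_add, ← Complex.ofReal_sub,
    Complex.norm_real, Complex.norm_real, Real.norm_eq_abs, Real.norm_eq_abs, sq_abs] at h
  linarith [le_abs_self (Real.exp x - (1 + x))]

/-- Near the origin, the moment generating function of a centered law with exponential moments is
bounded by that of a Gaussian law. -/
lemma IsNoiseLaw.exists_mgf_le (hF : IsNoiseLaw F) (hF1 : F ∈ LMinus 1) :
    ∃ t₀ K : ℝ, 0 < t₀ ∧ 0 < K ∧ ∀ t : ℝ, |t| ≤ t₀ →
      Integrable (fun x => Real.exp (t * x)) F ∧ mgf id F t ≤ Real.exp (K * t ^ 2) := by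
  have := hF.isProbability
  obtain ⟨t₁, ht₁, hint⟩ := exists_integrable_exp_of_mem_LMinus hF1
  set g : ℝ → ℝ := fun x => Real.exp (t₁ * x) + Real.exp (t₁ * -x) with hg
  have hgint : Integrable g F := hint.add (hF.integrable_comp_neg hint)
  have habs : ∀ x : ℝ, Real.exp (t₁ * |x|) ≤ g x := fun x => by
    rcases abs_cases x with ⟨h, -⟩ | ⟨h, -⟩ <;> rw [h, hg] <;>
      simp [(Real.exp_pos _).le]
  set M := ∫ x, g x ∂F with hM
  have hM0 : 0 ≤ M := integral_nonneg fun x => by positivity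
  -- One half of the exponent `t₁` absorbs `x ^ 2`, the other bounds `exp |t * x|`. The linear term
  -- integrates to zero by symmetry.
  set t₀ := t₁ / 2 with ht₀
  have ht₀pos : 0 < t₀ := by positivity
  refine ⟨t₀, 2 / t₀ ^ 2 * M + 1, by positivity, by positivity, fun t ht => ?_⟩
  have hbound : ∀ x : ℝ, Real.exp (t * x) ≤ 1 + t * x + t ^ 2 * (2 / t₀ ^ 2) * g x := fun x => by
    have h1 := exp_le_one_add_add_sq_mul_exp_abs (t * x)
    have h2 : Real.exp |t * x| ≤ Real.exp (t₀ * |x|) := by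
      rw [abs_mul]
      exact Real.exp_le_exp.2 (mul_le_mul_of_nonneg_right ht (abs_nonneg x))
    have h3 : x ^ 2 ≤ 2 / t₀ ^ 2 * Real.exp (t₀ * |x|) := by
      have := Real.pow_div_factorial_le_exp (t₀ * |x|) (by positivity) 2
      rw [mul_pow, sq_abs] at this
      rw [div_mul_eq_mul_div, le_div_iff₀ (by positivity)]
      norm_num at this
      linarith
    have h4 : (t * x) ^ 2 * Real.exp |t * x| ≤ t ^ 2 * (2 / t₀ ^ 2) * g x := by
      calc (t * x) ^ 2 * Real.exp |t * x|
          ≤ (t ^ 2 * (2 / t₀ ^ 2 * Real.exp (t₀ * |x|))) * Real.exp (t₀ * |x|) := by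
            rw [mul_pow]
            exact mul_le_mul (mul_le_mul_of_nonneg_left h3 (sq_nonneg t)) h2
              (Real.exp_pos _).le (by positivity)
        _ = t ^ 2 * (2 / t₀ ^ 2) * Real.exp (t₁ * |x|) := by
            rw [show t₁ * |x| = t₀ * |x| + t₀ * |x| by rw [ht₀]; ring, Real.exp_add]
            ring
        _ ≤ _ := mul_le_mul_of_nonneg_left (habs x) (by positivity)
    linarith
  have hRint : Integrable (fun x => 1 + t * x + t ^ 2 * (2 / t₀ ^ 2) * g x) F :=
    ((integrable_const 1).add (hF.integrable.const_mul t)).add (hgint.const_mul _)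
  have hexp : Integrable (fun x => Real.exp (t * x)) F := by
    refine hRint.mono' (by fun_prop) (Filter.Eventually.of_forall fun x => ?_)
    rw [Real.norm_eq_abs, abs_of_pos (Real.exp_pos _)]
    exact hbound x
  refine ⟨hexp, ?_⟩
  calc mgf id F t ≤ ∫ x, (1 + t * x + t ^ 2 * (2 / t₀ ^ 2) * g x) ∂F :=
        integral_mono hexp hRint hbound
    _ = 1 + t ^ 2 * (2 / t₀ ^ 2) * M := by
        have h1 : Integrable (fun x : ℝ => 1 + t * x) F :=
          (integrable_const 1).add (hF.integrable.const_mul t)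
        rw [integral_add h1 (hgint.const_mul _),
          integral_add (integrable_const 1) (hF.integrable.const_mul t), integral_const_mul,
          integral_const_mul, hF.integral_id, ← hM]
        simp
    _ ≤ (2 / t₀ ^ 2 * M + 1) * t ^ 2 + 1 := by nlinarith [sq_nonneg t]
    _ ≤ _ := Real.add_one_le_exp _

lemma IsNoiseLaw.memLp_two (hF : IsNoiseLaw F) (hF1 : F ∈ LMinus 1) : MemLp id 2 F := by
  have := hF.isProbability
  obtain ⟨t₁, ht₁, hint⟩ := exists_integrable_exp_of_mem_LMinus hF1
  refine (memLp_two_iff_integrable_sq measurable_id.aestronglyMeasurable).2 ?_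
  refine integrable_pow_of_integrable_exp_mul (X := id) ht₁.ne' hint ?_ 2
  simpa using hF.integrable_comp_neg hint

lemma IsNoiseLaw.variance_pos (hF : IsNoiseLaw F) (hF1 : F ∈ LMinus 1) : 0 < Var[id; F] := by
  have := hF.isProbability
  have h0 : F[id] = 0 := hF.integral_id
  rw [variance_of_integral_eq_zero measurable_id.aemeasurable h0]
  refine lt_of_le_of_ne (integral_nonneg fun x => sq_nonneg _) fun h => hF.nondegenerate ?_
  have h1 := (integral_eq_zero_iff_of_nonneg (fun x => sq_nonneg _)
    (hF.memLp_two hF1).integrable_sq).1 h.symm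
  have h2 : id =ᵐ[F] fun _ => (0 : ℝ) := by
    filter_upwards [h1] with x hx
    simpa using hx
  have h3 : F.map id = F.map fun _ => (0 : ℝ) := Measure.map_congr h2
  rw [Measure.map_id, Measure.map_const] at h3
  simpa using h3

end NoiseLaw

/-! ### The harness without wall: independent expansion and moments. -/

section FreeHarness

variable {d : ℕ} {p : Site d → Site d → ℝ} {Ω : Type*}

/-- The serial harness without wall, started from the flat configuration. -/
noncomputable def freeHarness (p : Site d → Site d → ℝ) (ε : ℕ → Site d → Ω → ℝ) :
    ℕ → Site d → Ω → ℝ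
  | 0 => fun _ _ => 0
  | n + 1 => fun i ω => ∑' j : Site d, p i j * freeHarness p ε n j ω + ε (n + 1) i ω

lemma IsHarnessKernel.freeHarness_succ (hp : IsHarnessKernel p) (ε : ℕ → Site d → Ω → ℝ) (n : ℕ)
    (i : Site d) (ω : Ω) : freeHarness p ε (n + 1) i ω =
      ∑ x ∈ hp.steps, p 0 x * freeHarness p ε n (i + x) ω + ε (n + 1) i ω := by
  simp only [freeHarness]
  rw [hp.tsum_kernel_mul fun j => freeHarness p ε n j ω]

lemma IsHarnessKernel.wall_succ (hp : IsHarnessKernel p) (ε : ℕ → Site d → Ω → ℝ) (n : ℕ)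
    (i : Site d) (ω : Ω) : wall p ε (n + 1) i ω =
      max (∑ x ∈ hp.steps, p 0 x * wall p ε n (i + x) ω + ε (n + 1) i ω) 0 := by
  simp only [wall]
  rw [hp.tsum_kernel_mul fun j => wall p ε n j ω]

lemma IsHarnessKernel.freeHarness_eq_sum (hp : IsHarnessKernel p) (ε : ℕ → Site d → Ω → ℝ)
    (n : ℕ) (i : Site d) (ω : Ω) : freeHarness p ε n i ω =
      ∑ r ∈ Finset.range n, ∑' z, stepProb p r 0 z * ε (n - r) (i + z) ω := by
  induction n generalizing i with
  | zero => simp [freeHarness]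
  | succ n ih =>
    rw [hp.freeHarness_succ, Finset.sum_range_succ',
      tsum_stepProb_zero_mul fun z => ε (n + 1 - 0) (i + z) ω]
    simp only [ih, Finset.mul_sum, Nat.sub_zero, add_zero]
    rw [Finset.sum_comm]
    congr 1
    refine Finset.sum_congr rfl fun r _ => ?_
    rw [hp.tsum_stepProb_succ_mul r fun z => ε (n + 1 - (r + 1)) (i + z) ω]
    refine Finset.sum_congr rfl fun x _ => ?_
    simp only [Nat.add_sub_add_right, add_assoc]

/-- The contribution to the free harness at time `n` and site `i` of the noise `q.1` time units
earlier at displacement `q.2`. -/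
noncomputable def noiseTerm (p : Site d → Site d → ℝ) (ε : ℕ → Site d → Ω → ℝ) (n : ℕ)
    (i : Site d) (q : Fin n × Site d) (ω : Ω) : ℝ :=
  stepProb p q.1 0 q.2 * ε (n - q.1) (i + q.2) ω

/-- A single finite index set serves for the process and for its squared weights, so facts on finite
sums of independent variables apply with `s(n)` as the total squared weight. -/
lemma IsHarnessKernel.exists_freeHarness_eq_sum (hp : IsHarnessKernel p)
    (ε : ℕ → Site d → Ω → ℝ) (n : ℕ) (i : Site d) : ∃ T : Finset (Fin n × Site d),
      freeHarness p ε n i = ∑ q ∈ T, noiseTerm p ε n i q ∧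
      ∑ q ∈ T, stepProb p q.1 0 q.2 ^ 2 = encounters p n := by
  classical
  set U : Finset (Site d) :=
    Finset.univ.biUnion fun r : Fin n => (hp.finite_support_stepProb r).toFinset with hU
  have h0 : ∀ (r : Fin n) (z : Site d), z ∉ U → stepProb p r 0 z = 0 := fun r z hz => by
    by_contra h
    exact hz (Finset.mem_biUnion.2 ⟨r, Finset.mem_univ r, by simpa using h⟩)
  refine ⟨Finset.univ ×ˢ U, ?_, ?_⟩
  · ext ω
    rw [hp.freeHarness_eq_sum, Finset.sum_apply, Finset.sum_product,
      Finset.sum_range fun r => ∑' z, stepProb p r 0 z * ε (n - r) (i + z) ω]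
    refine Finset.sum_congr rfl fun r _ => ?_
    rw [tsum_eq_sum (s := U) fun z hz => by simp [h0 r z hz]]
    rfl
  · rw [encounters, Finset.sum_product, Finset.sum_range fun r => ∑' z, stepProb p r 0 z ^ 2]
    refine Finset.sum_congr rfl fun r _ => ?_
    rw [tsum_eq_sum (s := U) fun z hz => by simp [h0 r z hz]]

lemma IsHarnessKernel.stepProb_le_one (hp : IsHarnessKernel p) (m : ℕ) (y : Site d) :
    stepProb p m 0 y ≤ 1 := by
  rw [← hp.tsum_stepProb m]
  exact (summable_of_hasFiniteSupport (hp.finite_support_stepProb m)).le_tsum y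
    fun z _ => hp.stepProb_nonneg m z

variable [MeasurableSpace Ω] {P : Measure Ω} {F : Measure ℝ} {ε : ℕ → Site d → Ω → ℝ}

lemma IsIIDNoise.measurable_noiseTerm (hε : IsIIDNoise P F ε) (n : ℕ) (i : Site d)
    (q : Fin n × Site d) : Measurable (noiseTerm p ε n i q) :=
  (hε.measurable _ _).const_mul _

lemma IsIIDNoise.iIndepFun_noiseTerm (hε : IsIIDNoise P F ε) (n : ℕ) (i : Site d) :
    iIndepFun (noiseTerm p ε n i) P := by
  -- Ages range over `Fin n`, so the subtraction never truncates and distinct indices use distinct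
  -- noise variables.
  have hinj : Function.Injective fun q : Fin n × Site d => (n - (q.1 : ℕ), i + q.2) := by
    rintro ⟨r, z⟩ ⟨r', z'⟩ h
    simp only [Prod.mk.injEq, add_right_inj] at h
    have : (r : ℕ) = r' := by omega
    exact Prod.ext (Fin.ext this) h.2
  exact (hε.indep.precomp hinj).comp (fun q x => stepProb p q.1 0 q.2 * x)
    fun q => measurable_const_mul _

lemma IsIIDNoise.integrable_comp (hε : IsIIDNoise P F ε) {g : ℝ → ℝ} (hg : Integrable g F) (n : ℕ)
    (i : Site d) : Integrable (fun ω => g (ε n i ω)) P := by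
  rw [← hε.law n i] at hg
  exact hg.comp_measurable (hε.measurable n i)

lemma IsIIDNoise.integral (hε : IsIIDNoise P F ε) (n : ℕ) (i : Site d) :
    ∫ ω, ε n i ω ∂P = ∫ x, x ∂F := by
  rw [← hε.law n i]
  exact (integral_map (hε.measurable n i).aemeasurable
    measurable_id.aestronglyMeasurable (f := fun x => x)).symm

lemma IsIIDNoise.mgf (hε : IsIIDNoise P F ε) (n : ℕ) (i : Site d) :
    mgf (ε n i) P = ProbabilityTheory.mgf id F := by
  rw [← hε.law n i, mgf_id_map (hε.measurable n i).aemeasurable]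

lemma IsIIDNoise.memLp_noiseTerm (hε : IsIIDNoise P F ε) (hF : MemLp id 2 F) (n : ℕ) (i : Site d)
    (q : Fin n × Site d) : MemLp (noiseTerm p ε n i q) 2 P := by
  have h : MemLp (ε (n - q.1) (i + q.2)) 2 P := by
    rw [← hε.law (n - q.1) (i + q.2)] at hF
    exact (memLp_map_measure_iff measurable_id.aestronglyMeasurable
      (hε.measurable _ _).aemeasurable).1 hF
  exact h.const_mul _

lemma IsIIDNoise.memLp_freeHarness (hε : IsIIDNoise P F ε) (hp : IsHarnessKernel p)
    (hF : MemLp id 2 F) (n : ℕ) (i : Site d) : MemLp (freeHarness p ε n i) 2 P := by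
  obtain ⟨T, hT, -⟩ := hp.exists_freeHarness_eq_sum ε n i
  rw [hT]
  exact memLp_finsetSum' T fun q _ => hε.memLp_noiseTerm hF n i q

lemma IsIIDNoise.integral_freeHarness [IsProbabilityMeasure P] (hε : IsIIDNoise P F ε)
    (hp : IsHarnessKernel p) (hF : MemLp id 2 F) (hF0 : ∫ x, x ∂F = 0) (n : ℕ) (i : Site d) :
    ∫ ω, freeHarness p ε n i ω ∂P = 0 := by
  obtain ⟨T, hT, -⟩ := hp.exists_freeHarness_eq_sum ε n i
  simp only [hT, Finset.sum_apply]
  rw [integral_finsetSum T fun q _ =>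
    (hε.memLp_noiseTerm hF n i q).integrable one_le_two]
  refine Finset.sum_eq_zero fun q _ => ?_
  simp only [noiseTerm]
  rw [integral_const_mul, hε.integral, hF0, mul_zero]

/-- The second moment of the free harness. -/
lemma IsIIDNoise.integral_freeHarness_sq [IsProbabilityMeasure P] (hε : IsIIDNoise P F ε)
    (hp : IsHarnessKernel p) (hF : MemLp id 2 F) (hF0 : ∫ x, x ∂F = 0) (n : ℕ) (i : Site d) :
    ∫ ω, freeHarness p ε n i ω ^ 2 ∂P = Var[id; F] * encounters p n := by
  have hmem := hε.memLp_freeHarness hp hF n i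
  have h0 := hε.integral_freeHarness hp hF hF0 n i
  have hv := variance_of_integral_eq_zero hmem.aestronglyMeasurable.aemeasurable h0
  rw [← hv]
  obtain ⟨T, hT, hs⟩ := hp.exists_freeHarness_eq_sum ε n i
  have hind := hε.iIndepFun_noiseTerm (p := p) n i
  rw [hT, IndepFun.variance_sum (fun q _ => hε.memLp_noiseTerm hF n i q)
    fun q _ q' _ hqq => hind.indepFun hqq, ← hs, Finset.mul_sum]
  refine Finset.sum_congr rfl fun q _ => ?_
  have h1 : Var[ε (n - q.1) (i + q.2); P] = Var[id; F] := by
    rw [← hε.law (n - q.1) (i + q.2), variance_map measurable_id.aemeasurable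
      (hε.measurable _ _).aemeasurable]
    rfl
  rw [show noiseTerm p ε n i q = fun ω => stepProb p q.1 0 q.2 * ε (n - q.1) (i + q.2) ω from rfl,
    variance_const_mul, h1, mul_comm]

/-- The free harness has a Gaussian bound on its moment generating function near the origin. -/
lemma IsIIDNoise.mgf_freeHarness_le [IsProbabilityMeasure P] (hε : IsIIDNoise P F ε)
    (hp : IsHarnessKernel p) {t₀ K : ℝ} (hmgf : ∀ t : ℝ, |t| ≤ t₀ →
      Integrable (fun x => Real.exp (t * x)) F ∧
        ProbabilityTheory.mgf id F t ≤ Real.exp (K * t ^ 2))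
    {t : ℝ} (ht : |t| ≤ t₀) (n : ℕ) (i : Site d) :
    Integrable (fun ω => Real.exp (t * freeHarness p ε n i ω)) P ∧
      ∫ ω, Real.exp (t * freeHarness p ε n i ω) ∂P ≤ Real.exp (K * t ^ 2 * encounters p n) := by
  obtain ⟨T, hT, hs⟩ := hp.exists_freeHarness_eq_sum ε n i
  have hind := hε.iIndepFun_noiseTerm (p := p) n i
  have hmeas := hε.measurable_noiseTerm (p := p) n i
  -- The weights are probabilities, so scaling by them keeps the argument in the range of `hmgf`.
  have hft : ∀ q : Fin n × Site d, |stepProb p q.1 0 q.2 * t| ≤ t₀ := fun q => by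
    rw [abs_mul, abs_of_nonneg (hp.stepProb_nonneg _ _)]
    exact (mul_le_of_le_one_left (abs_nonneg t) (hp.stepProb_le_one _ _)).trans ht
  rw [hT]
  constructor
  · refine hind.integrable_exp_mul_sum hmeas fun q _ => ?_
    have := hε.integrable_comp (hmgf _ (hft q)).1 (n - q.1) (i + q.2)
    simpa only [noiseTerm, mul_assoc, mul_left_comm t] using this
  · change ProbabilityTheory.mgf (∑ q ∈ T, noiseTerm p ε n i q) P t ≤ _
    rw [hind.mgf_sum hmeas, ← hs, Finset.mul_sum, Real.exp_sum]
    refine Finset.prod_le_prod (fun q _ => mgf_nonneg) fun q _ => ?_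
    have h1 : ProbabilityTheory.mgf (noiseTerm p ε n i q) P t =
        ProbabilityTheory.mgf id F (stepProb p q.1 0 q.2 * t) := by
      rw [← hε.mgf (n - q.1) (i + q.2), ← mgf_const_mul]
      rfl
    rw [h1]
    refine (hmgf _ (hft q)).2.trans (le_of_eq ?_)
    congr 1
    ring

end FreeHarness

/-! ### Comparison of the wall process with the free harness, and mean bounds. -/

section Wall

variable {d : ℕ} {p : Site d → Site d → ℝ} {Ω : Type*}

lemma wall_nonneg (ε : ℕ → Site d → Ω → ℝ) (n : ℕ) (i : Site d) (ω : Ω) :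
    0 ≤ wall p ε n i ω := by
  cases n with
  | zero => exact le_rfl
  | succ n => exact le_max_right _ _

lemma IsHarnessKernel.freeHarness_le_wall (hp : IsHarnessKernel p) (ε : ℕ → Site d → Ω → ℝ)
    (n : ℕ) (i : Site d) (ω : Ω) : freeHarness p ε n i ω ≤ wall p ε n i ω := by
  induction n generalizing i with
  | zero => exact le_rfl
  | succ n ih =>
    rw [hp.freeHarness_succ, hp.wall_succ]
    refine le_max_of_le_left (add_le_add_left (Finset.sum_le_sum fun x _ => ?_) _)
    exact mul_le_mul_of_nonneg_left (ih _) (hp.nonneg _ _)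

/-- The excess of the wall process over the raised free harness only grows when the latter is
negative. -/
lemma IsHarnessKernel.wall_excess_succ_le (hp : IsHarnessKernel p) (ε : ℕ → Site d → Ω → ℝ)
    (h : ℝ) (n : ℕ) (i : Site d) (ω : Ω) :
    max (wall p ε (n + 1) i ω - freeHarness p ε (n + 1) i ω - h) 0 ≤
      ∑ x ∈ hp.steps, p 0 x * max (wall p ε n (i + x) ω - freeHarness p ε n (i + x) ω - h) 0 +
        max (-h - freeHarness p ε (n + 1) i ω) 0 := by
  have hS : 0 ≤ ∑ x ∈ hp.steps,
      p 0 x * max (wall p ε n (i + x) ω - freeHarness p ε n (i + x) ω - h) 0 :=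
    Finset.sum_nonneg fun x _ => mul_nonneg (hp.nonneg _ _) (le_max_right _ _)
  have hS' : ∑ x ∈ hp.steps, p 0 x * wall p ε n (i + x) ω -
      ∑ x ∈ hp.steps, p 0 x * freeHarness p ε n (i + x) ω - h ≤ ∑ x ∈ hp.steps,
        p 0 x * max (wall p ε n (i + x) ω - freeHarness p ε n (i + x) ω - h) 0 := by
    have : h = ∑ x ∈ hp.steps, p 0 x * h := by rw [← Finset.sum_mul, hp.sum_steps, one_mul]
    nth_rewrite 1 [this]
    rw [← Finset.sum_sub_distrib, ← Finset.sum_sub_distrib]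
    refine Finset.sum_le_sum fun x _ => ?_
    rw [← mul_sub, ← mul_sub]
    exact mul_le_mul_of_nonneg_left (le_max_left _ _) (hp.nonneg _ _)
  have h1 := le_max_left (-h - freeHarness p ε (n + 1) i ω) 0
  have h2 := le_max_right (-h - freeHarness p ε (n + 1) i ω) 0
  refine max_le ?_ (by linarith)
  rw [hp.wall_succ]
  -- Off the wall both processes follow the same recursion and the noise cancels in the difference.
  -- At the wall the height is `0`, and the excess is exactly the last term.
  rcases le_total 0 (∑ x ∈ hp.steps, p 0 x * wall p ε n (i + x) ω + ε (n + 1) i ω) with h0 | h0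
  · rw [max_eq_left h0]
    have := hp.freeHarness_succ ε n i ω
    linarith
  · rw [max_eq_right h0]
    linarith

variable [MeasurableSpace Ω] {P : Measure Ω} {F : Measure ℝ} {ε : ℕ → Site d → Ω → ℝ}

lemma IsIIDNoise.integrable_wall [IsProbabilityMeasure P] (hε : IsIIDNoise P F ε)
    (hp : IsHarnessKernel p) (hF : Integrable (fun x => x) F) (n : ℕ) (i : Site d) :
    Integrable (wall p ε n i) P := by
  induction n generalizing i with
  | zero => exact integrable_zero _ _ _
  | succ n ih =>
    have h : Integrable (fun ω => ∑ x ∈ hp.steps, p 0 x * wall p ε n (i + x) ω + ε (n + 1) i ω) P :=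
      (integrable_finsetSum _ fun x _ => (ih (i + x)).const_mul _).add
        (hε.integrable_comp hF (n + 1) i)
    exact h.pos_part.congr (Filter.Eventually.of_forall fun ω => (hp.wall_succ ε n i ω).symm)

/-- Averaging by a stochastic kernel preserves a bound uniform in the site, so each time step adds
at most `B`; the initial excess is zero because `0 ≤ h`. -/
lemma IsIIDNoise.integral_wall_excess_le [IsProbabilityMeasure P] (hε : IsIIDNoise P F ε)
    (hp : IsHarnessKernel p) (hF : MemLp id 2 F) (hFi : Integrable (fun x => x) F) {h B : ℝ}
    {N : ℕ} (hB : ∀ n ≤ N, ∀ i, ∫ ω, max (-h - freeHarness p ε n i ω) 0 ∂P ≤ B)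
    {n : ℕ} (hn : n ≤ N) (hh : 0 ≤ h) (i : Site d) :
    ∫ ω, max (wall p ε n i ω - freeHarness p ε n i ω - h) 0 ∂P ≤ n * B := by
  have hY : ∀ n i, Integrable (freeHarness p ε n i) P := fun n i =>
    (hε.memLp_freeHarness hp hF n i).integrable one_le_two
  have hZ : ∀ n i, Integrable
      (fun ω => max (wall p ε n i ω - freeHarness p ε n i ω - h) 0) P := fun n i =>
    (((hε.integrable_wall hp hFi n i).sub (hY n i)).sub (integrable_const h)).pos_part
  induction n generalizing i with
  | zero => simp [wall, freeHarness, hh]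
  | succ n ih =>
    have hneg : Integrable (fun ω => max (-h - freeHarness p ε (n + 1) i ω) 0) P :=
      ((integrable_const (-h)).sub (hY (n + 1) i)).pos_part
    have hsum : Integrable (fun ω => ∑ x ∈ hp.steps,
        p 0 x * max (wall p ε n (i + x) ω - freeHarness p ε n (i + x) ω - h) 0) P :=
      integrable_finsetSum _ fun x _ => (hZ n (i + x)).const_mul _
    refine (integral_mono (hZ (n + 1) i) (hsum.add hneg)
      (hp.wall_excess_succ_le ε h n i)).trans ?_
    have hsplit := integral_add hsum hneg
    simp only [Pi.add_apply] at hsplit ⊢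
    rw [hsplit, integral_finsetSum _ fun x _ => (hZ n (i + x)).const_mul _]
    simp only [integral_const_mul]
    have h1 : ∑ x ∈ hp.steps, p 0 x *
        ∫ ω, max (wall p ε n (i + x) ω - freeHarness p ε n (i + x) ω - h) 0 ∂P ≤
          ∑ x ∈ hp.steps, p 0 x * (n * B) :=
      Finset.sum_le_sum fun x _ =>
        mul_le_mul_of_nonneg_left (ih (by omega) (i + x)) (hp.nonneg _ _)
    rw [← Finset.sum_mul, hp.sum_steps, one_mul] at h1
    push_cast
    linarith [hB (n + 1) hn i]

lemma exists_le_meanHeight (hp : IsHarnessKernel p) (hF : IsNoiseLaw F) (hF1 : F ∈ LMinus 1) :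
    ∃ c : ℝ, 0 < c ∧ ∀ (Ω : Type*) [MeasurableSpace Ω] (P : Measure Ω) [IsProbabilityMeasure P]
      (ε : ℕ → Site d → Ω → ℝ), IsIIDNoise P F ε → ∀ n : ℕ, 1 ≤ n →
        c * √(encounters p n) ≤ meanHeight P p ε n := by
  obtain ⟨t₀, K, ht₀, hK, hmgf⟩ := hF.exists_mgf_le hF1
  have hσ := hF.variance_pos hF1
  have hL2 := hF.memLp_two hF1
  set σ2 := Var[id; F] with hσ2
  -- `M * s ^ 2` bounds the fourth moment of the free harness. `L` is then chosen so that values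
  -- above `L * √s` account for at most half of the variance.
  set M : ℝ := 48 * Real.exp (K * t₀ ^ 2) / t₀ ^ 4 with hM
  have hMpos : 0 < M := by positivity
  set L : ℝ := √(2 * M / σ2) with hL
  have hLpos : 0 < L := Real.sqrt_pos.2 (by positivity)
  have hLsq : L ^ 2 = 2 * M / σ2 := Real.sq_sqrt (by positivity)
  refine ⟨σ2 / (4 * L), by positivity, fun Ω _ P _ ε hε n hn => ?_⟩
  have hs1 := hp.one_le_encounters hn
  set s := encounters p n with hs
  have hs0 : 0 < s := by linarith
  set a := √s with ha
  have ha1 : 1 ≤ a := Real.one_le_sqrt.2 hs1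
  have ha0 : 0 < a := by linarith
  have hasq : a ^ 2 = s := Real.sq_sqrt hs0.le
  set Y := freeHarness p ε n 0 with hY
  have hYL2 : MemLp Y 2 P := hε.memLp_freeHarness hp hL2 n 0
  have hYint : Integrable Y P := hYL2.integrable one_le_two
  -- This scaling makes `K * t ^ 2 * s` constant; `t ≤ t₀` since `s ≥ 1`, from the term `r = 0`.
  set t := t₀ / a with ht
  have htpos : 0 < t := by positivity
  have htle : |t| ≤ t₀ := by
    rw [abs_of_pos htpos]; exact div_le_self ht₀.le ha1
  have hts : K * t ^ 2 * s = K * t₀ ^ 2 := by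
    rw [ht, ← hasq]; field_simp
  obtain ⟨hi1, hb1⟩ := hε.mgf_freeHarness_le hp hmgf htle n 0
  obtain ⟨hi2, hb2⟩ := hε.mgf_freeHarness_le hp hmgf (t := -t) (by rwa [abs_neg]) n 0
  rw [neg_sq] at hb2
  rw [← hs, hts] at hb1 hb2
  set q : ℝ := 24 / (t ^ 4 * (L * a) ^ 2) with hq
  have hpt : ∀ ω, Y ω ^ 2 ≤ L * a * |Y ω| +
      q * (Real.exp (t * Y ω) + Real.exp (-t * Y ω)) := fun ω => by
    set y := Y ω
    have h4 : y ^ 4 ≤ 24 / t ^ 4 * (Real.exp (t * y) + Real.exp (-t * y)) := by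
      have h := Real.pow_div_factorial_le_exp (t * |y|) (by positivity) 4
      have habs : Real.exp (t * |y|) ≤ Real.exp (t * y) + Real.exp (-t * y) := by
        rcases abs_cases y with ⟨h, -⟩ | ⟨h, -⟩ <;> rw [h] <;>
          simp [(Real.exp_pos _).le]
      rw [mul_pow, Even.pow_abs (by decide)] at h
      rw [div_mul_eq_mul_div, le_div_iff₀ (by positivity)]
      norm_num [Nat.factorial] at h
      linarith
    have hq' : q * (Real.exp (t * y) + Real.exp (-t * y)) =
        24 / t ^ 4 * (Real.exp (t * y) + Real.exp (-t * y)) / (L * a) ^ 2 := by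
      rw [hq]; field_simp
    have h5 : y ^ 4 / (L * a) ^ 2 ≤ q * (Real.exp (t * y) + Real.exp (-t * y)) := by
      rw [hq']; exact div_le_div_of_nonneg_right h4 (by positivity)
    have hl : 0 < L * a := by positivity
    rcases le_total |y| (L * a) with h | h
    · have : y ^ 2 ≤ L * a * |y| := by
        rw [← sq_abs, sq]; exact mul_le_mul_of_nonneg_right h (abs_nonneg y)
      have : 0 ≤ y ^ 4 / (L * a) ^ 2 := by positivity
      linarith
    · have h6 : (L * a) ^ 2 ≤ y ^ 2 := by
        rw [← sq_abs y]; exact pow_le_pow_left₀ hl.le h 2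
      have h7 : y ^ 2 ≤ y ^ 4 / (L * a) ^ 2 := by
        rw [le_div_iff₀ (by positivity)]
        nlinarith [sq_nonneg y]
      have : 0 ≤ L * a * |y| := by positivity
      linarith
  have hint : Integrable (fun ω => q * (Real.exp (t * Y ω) + Real.exp (-t * Y ω))) P :=
    (hi1.add hi2).const_mul q
  have h1 := integral_mono hYL2.integrable_sq ((hYint.abs.const_mul (L * a)).add hint) hpt
  have h2 : ∫ ω, L * a * |Y ω| + q * (Real.exp (t * Y ω) + Real.exp (-t * Y ω)) ∂P =
      L * a * ∫ ω, |Y ω| ∂P +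
        q * (∫ ω, Real.exp (t * Y ω) ∂P + ∫ ω, Real.exp (-t * Y ω) ∂P) := by
    rw [integral_add (hYint.abs.const_mul (L * a)) hint, integral_const_mul, integral_const_mul,
      integral_add hi1 hi2]
  have hvar : ∫ ω, Y ω ^ 2 ∂P = σ2 * s :=
    hε.integral_freeHarness_sq hp hL2 hF.integral_id n 0
  have h3 : σ2 * s ≤ L * a * ∫ ω, |Y ω| ∂P + q * (2 * Real.exp (K * t₀ ^ 2)) := by
    rw [← hvar]
    refine h1.trans (le_of_eq_of_le h2 ?_)
    have : 0 ≤ q := by positivity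
    nlinarith
  have h4 : q * (2 * Real.exp (K * t₀ ^ 2)) = σ2 * s / 2 := by
    have e1 : q * (2 * Real.exp (K * t₀ ^ 2)) = M * a ^ 2 / L ^ 2 := by
      rw [hq, hM, ht]; field_simp; norm_num
    rw [e1, hLsq, hasq]; field_simp
  have hmean : (∫ ω, |Y ω| ∂P) / 2 ≤ meanHeight P p ε n := by
    have hY0 : ∫ ω, Y ω ∂P = 0 := hε.integral_freeHarness hp hL2 hF.integral_id n 0
    have h5 : ∫ ω, (Y ω + |Y ω|) / 2 ∂P ≤ meanHeight P p ε n := by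
      refine integral_mono ((hYint.add hYint.abs).div_const 2)
        (hε.integrable_wall hp hF.integrable n 0) fun ω => ?_
      have h6 := hp.freeHarness_le_wall ε n 0 ω
      have h7 := wall_nonneg (p := p) ε n 0 ω
      change (Y ω + |Y ω|) / 2 ≤ wall p ε n 0 ω
      rcases abs_cases (Y ω) with ⟨h, -⟩ | ⟨h, -⟩ <;> rw [h] <;> linarith
    rw [integral_div, integral_add hYint hYint.abs, hY0, zero_add] at h5
    exact h5
  have h8 : σ2 * a / (2 * L) ≤ ∫ ω, |Y ω| ∂P := by
    rw [div_le_iff₀ (by positivity)]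
    have h9 : a * (σ2 * a) ≤ a * ((∫ ω, |Y ω| ∂P) * (2 * L)) := by
      rw [← hasq] at h3 h4
      nlinarith
    exact le_of_mul_le_mul_left h9 ha0
  calc σ2 / (4 * L) * a = σ2 * a / (2 * L) / 2 := by ring
    _ ≤ (∫ ω, |Y ω| ∂P) / 2 := by linarith
    _ ≤ _ := hmean

lemma exists_meanHeight_le (hd1 : 1 ≤ d) (hd2 : d ≤ 2) (hp : IsHarnessKernel p)
    (hF : IsNoiseLaw F) (hF1 : F ∈ LMinus 1) :
    ∃ C : ℝ, 0 < C ∧ ∀ (Ω : Type*) [MeasurableSpace Ω] (P : Measure Ω) [IsProbabilityMeasure P]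
      (ε : ℕ → Site d → Ω → ℝ), IsIIDNoise P F ε → ∀ n : ℕ, 2 ≤ n →
        meanHeight P p ε n ≤ C * √(encounters p n * Real.log n) := by
  obtain ⟨t₀, K, ht₀, hK, hmgf⟩ := hF.exists_mgf_le hF1
  obtain ⟨κ, hκ, hlog⟩ := hp.exists_log_le_encounters hd1 hd2
  have hL2 := hF.memLp_two hF1
  -- The exponent will be `t = δ * √(log N / s)`; as `log N ≤ κ * s`, this choice of `δ` ensures `t
  -- ≤ t₀`.
  set δ : ℝ := t₀ / √κ with hδ
  have hκs : 0 < √κ := Real.sqrt_pos.2 hκ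
  have hδ0 : 0 < δ := by positivity
  -- Chosen so that `t * h` is `log N` plus the exponent `K * δ ^ 2 * log N` of the moment bound,
  -- leaving exactly `1 / N`.
  set H : ℝ := (1 + K * δ ^ 2) / δ with hH
  have hH0 : 0 < H := by positivity
  have hlog2 : 0 < Real.log 2 := Real.log_pos (by norm_num)
  refine ⟨H + 1 / (δ * Real.log 2), by positivity, fun Ω _ P _ ε hε N hN => ?_⟩
  have hs1 := hp.one_le_encounters (n := N) (by omega)
  set s := encounters p N with hs
  have hs0 : 0 < s := by linarith
  set ℓ := Real.log N with hℓ
  have hℓ2 : Real.log 2 ≤ ℓ := Real.log_le_log (by norm_num) (by exact_mod_cast hN)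
  have hℓ0 : 0 < ℓ := by linarith
  set a := √s with ha
  set b := √ℓ with hb
  have ha0 : 0 < a := Real.sqrt_pos.2 hs0
  have hb0 : 0 < b := Real.sqrt_pos.2 hℓ0
  have hasq : a ^ 2 = s := Real.sq_sqrt hs0.le
  have hbsq : b ^ 2 = ℓ := Real.sq_sqrt hℓ0.le
  rw [Real.sqrt_mul hs0.le]
  set t := δ * b / a with ht
  have ht0 : 0 < t := by positivity
  have htle : |-t| ≤ t₀ := by
    have h1 : b ≤ √κ * a := by
      rw [ha, ← Real.sqrt_mul hκ.le]
      exact Real.sqrt_le_sqrt (hlog N)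
    rw [abs_neg, abs_of_pos ht0, ht, div_le_iff₀ ha0, hδ, div_mul_eq_mul_div, div_le_iff₀ hκs]
    nlinarith
  set h := H * (a * b) with hh
  have hh0 : 0 ≤ h := by positivity
  set B := 1 / t * (N : ℝ)⁻¹ with hB
  have hN0 : (0 : ℝ) < N := by positivity
  have hBbound : ∀ n ≤ N, ∀ i, ∫ ω, max (-h - freeHarness p ε n i ω) 0 ∂P ≤ B := by
    intro n hn i
    obtain ⟨hi, hb'⟩ := hε.mgf_freeHarness_le hp hmgf htle n i
    have hYint := (hε.memLp_freeHarness hp hL2 n i).integrable one_le_two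
    -- Exponential Chebyshev in the form `max u 0 ≤ exp (t * u) / t`.
    have hpt : ∀ ω, max (-h - freeHarness p ε n i ω) 0 ≤
        1 / t * Real.exp (-(t * h)) * Real.exp (-t * freeHarness p ε n i ω) := fun ω => by
      rw [mul_assoc, ← Real.exp_add, one_div, inv_mul_eq_div]
      refine max_le ?_ (by positivity)
      rw [le_div_iff₀ ht0]
      refine le_trans (le_of_eq ?_) ((lt_add_one _).le.trans (Real.add_one_le_exp _))
      ring
    refine (integral_mono ((integrable_const (-h)).sub hYint).pos_part
      (hi.const_mul _) hpt).trans ?_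
    rw [integral_const_mul, hB, mul_assoc]
    refine mul_le_mul_of_nonneg_left ?_ (by positivity)
    calc Real.exp (-(t * h)) * ∫ ω, Real.exp (-t * freeHarness p ε n i ω) ∂P
        ≤ Real.exp (-(t * h)) * Real.exp (K * t ^ 2 * s) := by
          refine mul_le_mul_of_nonneg_left (hb'.trans ?_) (Real.exp_pos _).le
          rw [neg_sq]
          exact Real.exp_le_exp.2
            (mul_le_mul_of_nonneg_left (hp.encounters_mono hn) (by positivity))
      _ = (N : ℝ)⁻¹ := by
          have h1 : t * h = (1 + K * δ ^ 2) * ℓ := by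
            rw [ht, hh, hH, ← hbsq]; field_simp
          have h2 : K * t ^ 2 * s = K * δ ^ 2 * ℓ := by
            rw [ht, ← hasq, ← hbsq]; field_simp
          rw [← Real.exp_add, h1, h2, show -((1 + K * δ ^ 2) * ℓ) + K * δ ^ 2 * ℓ = -ℓ by ring,
            Real.exp_neg, hℓ, Real.exp_log hN0]
  have hexc := hε.integral_wall_excess_le hp hL2 hF.integrable hBbound le_rfl hh0 0
  have hYint := (hε.memLp_freeHarness hp hL2 N 0).integrable one_le_two
  have hW := hε.integrable_wall hp hF.integrable N 0
  have hWY : Integrable (fun ω => wall p ε N 0 ω - freeHarness p ε N 0 ω) P := hW.sub hYint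
  have h1 : ∫ ω, (wall p ε N 0 ω - freeHarness p ε N 0 ω - h) ∂P ≤ N * B :=
    (integral_mono (hWY.sub (integrable_const h))
      (hWY.sub (integrable_const h)).pos_part fun ω => le_max_left _ _).trans hexc
  rw [integral_sub hWY (integrable_const h), integral_sub hW hYint,
    hε.integral_freeHarness hp hL2 hF.integral_id, integral_const] at h1
  -- The total gain is `1 / t`, which is `√(s * log N)` divided by `δ * log N`; `N ≥ 2` keeps the
  -- logarithm away from zero.
  have hNB : N * B ≤ 1 / (δ * Real.log 2) * (a * b) := by
    have e1 : N * B = a * b / (δ * ℓ) := by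
      rw [hB, ht, ← hbsq]; field_simp
    rw [e1, one_div, inv_mul_eq_div]
    exact div_le_div_of_nonneg_left (by positivity) (by positivity)
      (mul_le_mul_of_nonneg_left hℓ2 hδ0.le)
  have h2 : meanHeight P p ε N ≤ h + N * B := by
    simp only [probReal_univ, sub_zero, one_smul] at h1
    rw [meanHeight]
    linarith
  rw [add_mul]
  linarith

end Wall

end SerialHarness

/-! ### Assembly: the general bounds combined with the growth of encounters. -/

theorem theorem5 (d : ℕ) (hd1 : 1 ≤ d) (hd2 : d ≤ 2)
    (p : SerialHarness.Site d → SerialHarness.Site d → ℝ) (hp : SerialHarness.IsHarnessKernel p)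
    (F : Measure ℝ) (hF : SerialHarness.IsNoiseLaw F) (hF1 : F ∈ SerialHarness.LMinus 1) :
    ∃ c C : ℝ, 0 < c ∧ 0 < C ∧
      ∀ (Ω : Type*) [MeasurableSpace Ω] (P : Measure Ω) [IsProbabilityMeasure P]
        (ε : ℕ → SerialHarness.Site d → Ω → ℝ), SerialHarness.IsIIDNoise P F ε →
        (∀ n : ℕ, Integrable (SerialHarness.wall p ε n 0) P) ∧
        (∀ n : ℕ, 1 ≤ n →
          c * √(SerialHarness.encounters p n) ≤ SerialHarness.meanHeight P p ε n) ∧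
        (∀ n : ℕ, 2 ≤ n →
          SerialHarness.meanHeight P p ε n ≤ C * √(SerialHarness.encounters p n * Real.log n)) ∧
        (d = 1 →
          (∀ n : ℕ, 1 ≤ n →
            c * (n : ℝ) ^ (1 / 4 : ℝ) ≤ SerialHarness.meanHeight P p ε n) ∧
          (∀ n : ℕ, 2 ≤ n →
            SerialHarness.meanHeight P p ε n ≤ C * (n : ℝ) ^ (1 / 4 : ℝ) * √(Real.log n))) ∧
        (d = 2 →
          (∀ n : ℕ, 1 ≤ n →
            c * √(Real.log n) ≤ SerialHarness.meanHeight P p ε n) ∧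
          (∀ n : ℕ, 2 ≤ n →
            SerialHarness.meanHeight P p ε n ≤ C * Real.log n)) := by
  obtain ⟨c, hc, hlow⟩ := SerialHarness.exists_le_meanHeight hp hF hF1
  obtain ⟨C, hC, hup⟩ := SerialHarness.exists_meanHeight_le hd1 hd2 hp hF hF1
  obtain rfl | rfl : d = 1 ∨ d = 2 := by omega
  · obtain ⟨b, B, hb, hB, hs⟩ := hp.encounters_one_dim
    have hroot : ∀ n : ℕ, √(√(n : ℝ)) = (n : ℝ) ^ (1 / 4 : ℝ) := fun n => by
      rw [Real.sqrt_eq_rpow, Real.sqrt_eq_rpow, ← Real.rpow_mul (Nat.cast_nonneg n)]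
      norm_num
    have hb' : 0 < √b := Real.sqrt_pos.2 hb
    have hB' : 0 < √B := Real.sqrt_pos.2 hB
    -- One pair of constants must serve both the bounds in `s(n)` and the explicit rates.
    refine ⟨min c (c * √b), max C (C * √B), by positivity, by positivity,
      fun Ω _ P _ ε hε => ⟨fun n => hε.integrable_wall hp hF.integrable n 0, fun n hn => ?_,
        fun n hn => ?_, fun _ => ⟨fun n hn => ?_, fun n hn => ?_⟩, fun h => by omega⟩⟩
    · exact (mul_le_mul_of_nonneg_right (min_le_left _ _) (Real.sqrt_nonneg _)).trans
        (hlow Ω P ε hε n hn)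
    · exact (hup Ω P ε hε n hn).trans
        (mul_le_mul_of_nonneg_right (le_max_left _ _) (Real.sqrt_nonneg _))
    · refine le_trans ?_ (hlow Ω P ε hε n hn)
      calc min c (c * √b) * (n : ℝ) ^ (1 / 4 : ℝ) ≤ c * √b * (n : ℝ) ^ (1 / 4 : ℝ) :=
            mul_le_mul_of_nonneg_right (min_le_right _ _) (by positivity)
        _ = c * √(b * √n) := by rw [Real.sqrt_mul hb.le, hroot, mul_assoc]
        _ ≤ _ := mul_le_mul_of_nonneg_left (Real.sqrt_le_sqrt (hs n).1) hc.le
    · refine (hup Ω P ε hε n hn).trans ?_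
      have hlog : 0 ≤ Real.log n := Real.log_natCast_nonneg n
      calc C * √(SerialHarness.encounters p n * Real.log n)
          ≤ C * √(B * √n * Real.log n) := mul_le_mul_of_nonneg_left
            (Real.sqrt_le_sqrt (mul_le_mul_of_nonneg_right (hs n).2 hlog)) hC.le
        _ = C * √B * (n : ℝ) ^ (1 / 4 : ℝ) * √(Real.log n) := by
            rw [Real.sqrt_mul (by positivity), Real.sqrt_mul hB.le, hroot]
            ring
        _ ≤ _ := by
            gcongr
            exact le_max_right _ _
  · obtain ⟨b, B, hb, hB, hs1, hs2⟩ := hp.encounters_two_dim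
    have hb' : 0 < √b := Real.sqrt_pos.2 hb
    have hB' : 0 < √B := Real.sqrt_pos.2 hB
    refine ⟨min c (c * √b), max C (C * √B), by positivity, by positivity,
      fun Ω _ P _ ε hε => ⟨fun n => hε.integrable_wall hp hF.integrable n 0, fun n hn => ?_,
        fun n hn => ?_, fun h => by omega, fun _ => ⟨fun n hn => ?_, fun n hn => ?_⟩⟩⟩
    · exact (mul_le_mul_of_nonneg_right (min_le_left _ _) (Real.sqrt_nonneg _)).trans
        (hlow Ω P ε hε n hn)
    · exact (hup Ω P ε hε n hn).trans
        (mul_le_mul_of_nonneg_right (le_max_left _ _) (Real.sqrt_nonneg _))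
    · refine le_trans ?_ (hlow Ω P ε hε n hn)
      calc min c (c * √b) * √(Real.log n) ≤ c * √b * √(Real.log n) :=
            mul_le_mul_of_nonneg_right (min_le_right _ _) (by positivity)
        _ = c * √(b * Real.log n) := by rw [Real.sqrt_mul hb.le, mul_assoc]
        _ ≤ _ := mul_le_mul_of_nonneg_left (Real.sqrt_le_sqrt (hs1 n)) hc.le
    · refine (hup Ω P ε hε n hn).trans ?_
      have hlog : 0 ≤ Real.log n := Real.log_natCast_nonneg n
      calc C * √(SerialHarness.encounters p n * Real.log n)
          ≤ C * √(B * (Real.log n * Real.log n)) := by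
            rw [← mul_assoc]
            exact mul_le_mul_of_nonneg_left
              (Real.sqrt_le_sqrt (mul_le_mul_of_nonneg_right (hs2 n hn) hlog)) hC.le
        _ = C * √B * Real.log n := by
            rw [Real.sqrt_mul hB.le, Real.sqrt_mul_self hlog, mul_assoc]
        _ ≤ _ := mul_le_mul_of_nonneg_right (le_max_right _ _) hlog
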